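/- Fix a mass $m>0$, a renormalization length $\lambda>0$, Newton's constant $\mathrm G>0$, a cosmological constant $\Lambda\in\mathbb R$, initial values $a_0>0$ and $H_0\in\mathbb R$, and times $\tau_0<\tau_1$. Put $H_c=\sqrt{180\pi/\mathrm G}$. For a continuous function $H$ on an interval starting at $\tau_0$ put $$a(H)(\tau)=a_0\Big(1-a_0\int_{\tau_0}^\tau H(\eta)\,d\eta\Big)^{-1},\qquad V(\tau)=m^2\big(a(\tau)^2-a_0^2\big),\qquad k_0=\sqrt{k^2+a_0^2m^2}\quad(k\ge 0),$$ where $a=a(H)$. Let $\chi_k=\sum_{n\ge0}\chi_k^{(n)}$ with $$\chi_k^{(0)}(\tau)=\frac{e^{ik_0\tau}}{\sqrt{2k_0}},\qquad \chi_k^{(n)}(\tau)=\int_{\tau_0}^\tau\frac{\sin(k_0(\eta-\tau))}{k_0}\,V(\eta)\,\chi_k^{(n-1)}(\eta)\,d\eta\quad(n\ge1),$$ and define the renormalized Wick square of this state by $$w(H)(\tau)=\frac{1}{(2\pi)^3a(\tau)^2}\lim_{\varepsilon\to0^+}\int_{\mathbb R^3}\Big(|\chi_k(\tau)|^2-\frac1{2k_0}+\frac{V(\tau)}{4k_0^3}\Big)e^{-\varepsilon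 k}\,d\vec k+\frac{m^2}{(4\pi)^2}\Big(\frac12-\frac{a_0^2}{a(\tau)^2}+2\ln\frac{a_0}{a(\tau)}+2\ln\frac{e^\gamma m\lambda}{\sqrt2}\Big),$$ where $k=|\vec k|$ and $\gamma$ is Euler's constant. For $\tau>\tau_0$, a solution in $C[\tau_0,\tau]$ of the semiclassical Friedmann equation is a continuous function $H$ on $[\tau_0,\tau]$ such that for all $s\in[\tau_0,\tau]$ $$H(s)=H_0+\int_{\tau_0}^s\frac{a(H)(\eta)}{H_c^2-H(\eta)^2}\Big(H(\eta)^4-2H_c^2H(\eta)^2-\tfrac{15}{2}m^4+240\pi^2\big(m^2\,w(H)(\eta)+4\Lambda\big)\Big)d\eta .$$ It is called regular if $|H(s)|<H_c$ and $a_0\int_{\tau_0}^s H(\eta)\,d\eta<1$ for all $s\in[\tau_0,\tau]$. Theorem. Let $H_*\in C[\tau_0,\tau_1]$ be a regular solution. Then there is $\tau_2>\tau_1$ such that $H_*$ extends to exactly one solution $H\in C[\tau_0,\tau_2]$, and this extension $H$ is regular on $[\tau_0,\tau_2]$. (In particular all series, integrals and limits in the equation for $H$ converge.) -/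

import Mathlib

open Filter Topology MeasureTheory

noncomputable section

namespace SemiclassicalFriedmann

/-- The critical Hubble rate: `H_c ^ 2 = 180 π / G`, with `G` Newton's constant. -/
def criticalHubble (G : ℝ) : ℝ := Real.sqrt (180 * Real.pi / G)

/-- The scale factor as a functional of the conformal-time Hubble function `H`, with initial
value `a₀` at conformal time `τ₀`. -/
def scaleFactor (a₀ τ₀ : ℝ) (H : ℝ → ℝ) (τ : ℝ) : ℝ :=
  a₀ * (1 - a₀ * ∫ η in τ₀..τ, H η)⁻¹

/-- The initial frequency `k₀ = √(k² + a(τ₀)² m²)` of the mode of wave number `k`. -/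
def initialFrequency (m τ₀ : ℝ) (a : ℝ → ℝ) (k : ℝ) : ℝ :=
  Real.sqrt (k ^ 2 + a τ₀ ^ 2 * m ^ 2)

/-- The potential `V(τ) = m² (a(τ)² - a(τ₀)²)`. -/
def potential (m τ₀ : ℝ) (a : ℝ → ℝ) (τ : ℝ) : ℝ :=
  m ^ 2 * (a τ ^ 2 - a τ₀ ^ 2)

/-- The partial modes `χ_k^(n)` of the adiabatic state of order zero at `τ₀`. -/
def partialMode (m τ₀ : ℝ) (a : ℝ → ℝ) (k : ℝ) : ℕ → ℝ → ℂ
  | 0, τ =>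
      ((1 / Real.sqrt (2 * initialFrequency m τ₀ a k) : ℝ) : ℂ) *
        Complex.exp (Complex.I * ((initialFrequency m τ₀ a k * τ : ℝ) : ℂ))
  | n + 1, τ =>
      ∫ η in τ₀..τ,
        ((Real.sin (initialFrequency m τ₀ a k * (η - τ)) / initialFrequency m τ₀ a k *
          potential m τ₀ a η : ℝ) : ℂ) * partialMode m τ₀ a k n η

/-- The modes `χ_k = ∑ₙ χ_k^(n)`. -/
def mode (m τ₀ : ℝ) (a : ℝ → ℝ) (k τ : ℝ) : ℂ :=
  ∑' n : ℕ, partialMode m τ₀ a k n τ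

/-- The subtracted mode density `|χ_k|² - 1/(2 k₀) + V/(4 k₀³)`. -/
def subtractedMode (m τ₀ : ℝ) (a : ℝ → ℝ) (τ k : ℝ) : ℝ :=
  ‖mode m τ₀ a k τ‖ ^ 2 - 1 / (2 * initialFrequency m τ₀ a k) +
    potential m τ₀ a τ / (4 * initialFrequency m τ₀ a k ^ 3)

/-- The integral of the subtracted mode density over `ℝ³`, with the cut-off `e^{-ε k}`. -/
def cutoffModeIntegral (m τ₀ : ℝ) (a : ℝ → ℝ) (τ ε : ℝ) : ℝ :=
  ∫ k : EuclideanSpace ℝ (Fin 3), subtractedMode m τ₀ a τ ‖k‖ * Real.exp (-ε * ‖k‖)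

/-- The integral of the subtracted mode density over `ℝ³`, as the limit `ε → 0⁺` of the integrals
with cut-off (it need not converge absolutely). -/
def modeIntegral (m τ₀ : ℝ) (a : ℝ → ℝ) (τ : ℝ) : ℝ :=
  limUnder (𝓝[>] (0 : ℝ)) (cutoffModeIntegral m τ₀ a τ)

/-- The renormalized Wick square at conformal time `τ` of the adiabatic state of order zero, for a
field of mass `m` and renormalization length `lam`, on the flat spacetime with scale factor `a`. -/
def wickSquare (m lam τ₀ : ℝ) (a : ℝ → ℝ) (τ : ℝ) : ℝ :=
  1 / ((2 * Real.pi) ^ 3 * a τ ^ 2) * modeIntegral m τ₀ a τ +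
    m ^ 2 / (4 * Real.pi) ^ 2 *
      (1 / 2 - (a τ₀ / a τ) ^ 2 + 2 * Real.log (a τ₀ / a τ) +
        2 * Real.log (Real.exp Real.eulerMascheroniConstant * m * lam / Real.sqrt 2))

/-- The integrand `f(H)` of the semiclassical Friedmann equation; `Lam` is the cosmological
constant. -/
def friedmannIntegrand (m lam G Lam a₀ τ₀ : ℝ) (H : ℝ → ℝ) (η : ℝ) : ℝ :=
  scaleFactor a₀ τ₀ H η / (criticalHubble G ^ 2 - H η ^ 2) *
    (H η ^ 4 - 2 * criticalHubble G ^ 2 * H η ^ 2 - 15 / 2 * m ^ 4 +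
      240 * Real.pi ^ 2 * (m ^ 2 * wickSquare m lam τ₀ (scaleFactor a₀ τ₀ H) η + 4 * Lam))

/-- `H` is a solution in `C[τ₀, τ₁]` of the integrated semiclassical Friedmann equation with
initial values `a₀`, `H₀` at `τ₀`. Only the values of `H` on `[τ₀, τ₁]` matter. -/
structure IsSolution (m lam G Lam a₀ H₀ τ₀ τ₁ : ℝ) (H : ℝ → ℝ) : Prop where
  continuousOn : ContinuousOn H (Set.Icc τ₀ τ₁)
  equation : ∀ τ ∈ Set.Icc τ₀ τ₁,
    H τ = H₀ + ∫ η in τ₀..τ, friedmannIntegrand m lam G Lam a₀ τ₀ H η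

/-- Regularity on `[τ₀, τ₁]`: neither `a`, nor `H`, nor `H'` meets a singularity. -/
structure IsRegular (G a₀ τ₀ τ₁ : ℝ) (H : ℝ → ℝ) : Prop where
  abs_lt : ∀ τ ∈ Set.Icc τ₀ τ₁, |H τ| < criticalHubble G
  integral_lt : ∀ τ ∈ Set.Icc τ₀ τ₁, a₀ * ∫ η in τ₀..τ, H η < 1

/-- All series, integrals and limits that enter the equation for `H` on `[τ₀, τ₁]` converge. -/
structure Converges (m lam G Lam a₀ τ₀ τ₁ : ℝ) (H : ℝ → ℝ) : Prop where
  summable : ∀ τ ∈ Set.Icc τ₀ τ₁, ∀ k : ℝ,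
    Summable fun n : ℕ => partialMode m τ₀ (scaleFactor a₀ τ₀ H) k n τ
  integrable : ∀ τ ∈ Set.Icc τ₀ τ₁, ∀ ε : ℝ, 0 < ε →
    Integrable fun k : EuclideanSpace ℝ (Fin 3) =>
      subtractedMode m τ₀ (scaleFactor a₀ τ₀ H) τ ‖k‖ * Real.exp (-ε * ‖k‖)
  tendsto : ∀ τ ∈ Set.Icc τ₀ τ₁,
    Tendsto (cutoffModeIntegral m τ₀ (scaleFactor a₀ τ₀ H) τ) (𝓝[>] (0 : ℝ))
      (𝓝 (modeIntegral m τ₀ (scaleFactor a₀ τ₀ H) τ))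
  intervalIntegrable :
    IntervalIntegrable (friedmannIntegrand m lam G Lam a₀ τ₀ H) volume τ₀ τ₁

end SemiclassicalFriedmann

end

/-! The equation reads H = H₀ + ∫ f(H), where f(H) at time t depends on H only through its values on
[τ₀, t]. Once f is bounded and Lipschitz in the sup norm near the given solution, Banach's fixed
point theorem on a short interval past τ₁ yields the extension. The work lies in this Lipschitz
bound: the Wick square contains a momentum integral that need not converge absolutely, and its
estimate must not cost a derivative of H.

Since a' = a²H, the derivative v = V' = 2m²a³H contains no derivative of H. The function ρ =
2k₀|χ_k|² solves ρ''' + 4k₀²ρ' = -4Vρ' - 2vρ with ρ = 1, ρ' = ρ'' = 0 at τ₀. With the right hand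
side written as F - 2v, F solves a Volterra equation whose kernel is O(1/k₀) (`exists_response`);
hence F is O(1/k₀) and Lipschitz in v at the same rate (`abs_response_sub_le`). In the formula for
ρ, the term -2v produces exactly the subtraction V/(4k₀³) and a first order density (4k₀³)⁻¹ ∫
cos(2k₀(τ-η)) v(η) dη, while F contributes O(k₀⁻⁴), which is absolutely integrable against k² dk
(`exists_higherOrderDensity_lipschitz`).

The first order density is controlled only by k₀⁻³. With the cut-off, Fubini turns its momentum
integral into a convolution of v with `oscKernel`. One integration by parts in k and |sin x| ≤ √x
bound this kernel by a multiple of s^(-1/2), uniformly in ε (`abs_oscKernel_le`). This is integrable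
in s, so the limit ε → 0 exists and is Lipschitz in the sup norm of v
(`exists_limitIntegral_lipschitz`). The remaining ingredients are C¹ functions on a compact box
where a₀/a stays away from 0 and |H| below H_c, which gives `exists_friedmannIntegrand_bounds`.

`exists_continuation` is the contraction argument. A competing solution need not stay near the given
one, so `eqOn_of_continuation` propagates agreement: where it agrees with the fixed point it is
within r/2 of the reference function, hence within r slightly later, where local uniqueness applies.
-/

noncomputable section

namespace SemiclassicalFriedmann

/-! ### Frequencies and the oscillatory kernel -/

/-- The frequency `√(k² + μ²)`. -/
def freq (μ k : ℝ) : ℝ := Real.sqrt (k ^ 2 + μ ^ 2)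

lemma freq_sq (μ k : ℝ) : freq μ k ^ 2 = k ^ 2 + μ ^ 2 := Real.sq_sqrt (by positivity)

lemma freq_nonneg (μ k : ℝ) : 0 ≤ freq μ k := Real.sqrt_nonneg _

lemma le_freq_left (μ k : ℝ) : μ ≤ freq μ k :=
  Real.le_sqrt_of_sq_le (by nlinarith [sq_nonneg k])

lemma le_freq_right (μ k : ℝ) : k ≤ freq μ k :=
  Real.le_sqrt_of_sq_le (by nlinarith [sq_nonneg μ])

lemma freq_pos {μ : ℝ} (hμ : 0 < μ) (k : ℝ) : 0 < freq μ k := hμ.trans_le (le_freq_left μ k)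

lemma continuous_freq (μ : ℝ) : Continuous (freq μ) := by
  unfold freq; fun_prop

lemma hasDerivAt_freq {μ : ℝ} (hμ : 0 < μ) (k : ℝ) :
    HasDerivAt (freq μ) (k / freq μ k) k := by
  have h : HasDerivAt (fun k : ℝ => k ^ 2 + μ ^ 2) (2 * k) k := by
    simpa using (hasDerivAt_pow 2 k).add_const (μ ^ 2)
  have := h.sqrt (by positivity)
  rw [mul_div_mul_left _ _ two_ne_zero] at this
  exact this

lemma one_add_le_freq {μ k : ℝ} (hμ : 0 < μ) : 1 + k ≤ (1 + 1 / μ) * freq μ k := by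
  have h1 := le_freq_left μ k
  have h2 := le_freq_right μ k
  have h3 : 1 ≤ 1 / μ * freq μ k := by
    rw [one_div, inv_mul_eq_div, le_div_iff₀ hμ]; linarith
  linarith

/-- Decay of the frequency makes `freq ^ (-r)` integrable for `r > 1`. -/
lemma integrableOn_freq_rpow {μ r : ℝ} (hμ : 0 < μ) (hr : 1 < r) :
    IntegrableOn (fun k => freq μ k ^ (-r)) (Set.Ioi 0) := by
  have h1 : Integrable (fun k : ℝ => (1 + ‖k‖) ^ (-r)) :=
    integrable_one_add_norm (by simpa using hr)
  refine Integrable.mono' ((h1.integrableOn (s := Set.Ioi 0)).const_mul ((1 + 1 / μ) ^ r)) ?_ ?_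
  · refine (Continuous.aestronglyMeasurable ?_)
    exact (continuous_freq μ).rpow_const fun k => Or.inl (freq_pos hμ k).ne'
  · refine (ae_restrict_mem measurableSet_Ioi).mono fun k hk => ?_
    have hk : 0 < k := hk
    have hf := freq_pos hμ k
    rw [Real.norm_of_nonneg (by positivity), Real.norm_of_nonneg hk.le]
    have h2 := one_add_le_freq (k := k) hμ
    have h3 : (1 + k) ^ r ≤ (1 + 1 / μ) ^ r * freq μ k ^ r := by
      rw [← Real.mul_rpow (by positivity) hf.le]
      exact Real.rpow_le_rpow (by positivity) h2 (by linarith)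
    rw [Real.rpow_neg hf.le, Real.rpow_neg (by positivity), ← div_eq_mul_inv,
      le_div_iff₀ (by positivity), inv_mul_le_iff₀ (by positivity)]
    linarith

/-- Interpolates between |sin x| ≤ 1 and |sin x| ≤ x. The exponent 1/2 leaves a singularity in s and
a decay in k that are both integrable. -/
lemma abs_sin_le_sqrt {x : ℝ} (hx : 0 ≤ x) : |Real.sin x| ≤ Real.sqrt x := by
  refine Real.le_sqrt_of_sq_le ?_
  have h1 := Real.abs_sin_le_one x
  have h2 : |Real.sin x| ≤ x := by simpa [abs_of_nonneg hx] using Real.abs_sin_le_abs (x := x)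
  nlinarith [abs_nonneg (Real.sin x)]

/-- The oscillatory kernel of the first order contribution, with cut-off. -/
def oscKernel (μ ε s : ℝ) : ℝ :=
  ∫ k in Set.Ioi (0 : ℝ), k ^ 2 / freq μ k ^ 3 * Real.cos (2 * freq μ k * s) * Real.exp (-ε * k)

/-- The integrand of `oscKernel` after an integration by parts. -/
def oscDensity (μ ε s k : ℝ) : ℝ :=
  -(Real.sin (2 * freq μ k * s) / (2 * s) *
    ((1 / freq μ k ^ 2 - 2 * k ^ 2 / freq μ k ^ 4 - ε * k / freq μ k ^ 2) * Real.exp (-ε * k)))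

lemma continuous_oscDensity {μ : ℝ} (hμ : 0 < μ) (ε s : ℝ) : Continuous (oscDensity μ ε s) := by
  unfold oscDensity
  have h := continuous_freq μ
  have h0 : ∀ k, freq μ k ≠ 0 := fun k => (freq_pos hμ k).ne'
  have h2 : ∀ k, freq μ k ^ 2 ≠ 0 := fun k => pow_ne_zero _ (h0 k)
  have h4 : ∀ k, freq μ k ^ 4 ≠ 0 := fun k => pow_ne_zero _ (h0 k)
  fun_prop (disch := assumption)

lemma abs_oscDensity_le {μ ε s k : ℝ} (hμ : 0 < μ) (hε : 0 ≤ ε) (hs : 0 < s) (hk : 0 < k) :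
    |oscDensity μ ε s k| ≤ 4 * s ^ (-(1 / 2) : ℝ) * freq μ k ^ (-(3 / 2) : ℝ) := by
  have hf := freq_pos hμ k
  have hsq := freq_sq μ k
  set w := freq μ k with hw
  -- The 4 is 1 + 2 + 1; the last 1 bounds ε k e^(-εk), which makes the estimate uniform in ε.
  have hA : |(1 / w ^ 2 - 2 * k ^ 2 / w ^ 4 - ε * k / w ^ 2) * Real.exp (-ε * k)| ≤ 4 / w ^ 2 := by
    have h1 : 0 < Real.exp (-ε * k) := Real.exp_pos _
    have h2 : Real.exp (-ε * k) ≤ 1 := Real.exp_le_one_iff.2 (by nlinarith [mul_nonneg hε hk.le])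
    have h3 : ε * k * Real.exp (-ε * k) ≤ 1 := by
      have := Real.add_one_le_exp (ε * k)
      have h4 : Real.exp (ε * k) * Real.exp (-ε * k) = 1 := by
        rw [← Real.exp_add]; simp
      nlinarith
    have h5 : 2 * k ^ 2 / w ^ 4 ≤ 2 / w ^ 2 := by
      rw [div_le_div_iff₀ (by positivity) (by positivity)]
      have : k ^ 2 ≤ w ^ 2 := by nlinarith [sq_nonneg μ]
      nlinarith [mul_le_mul_of_nonneg_right this (by positivity : (0 : ℝ) ≤ 2 * w ^ 2)]
    have h6 : 0 ≤ 2 * k ^ 2 / w ^ 4 := by positivity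
    have h7 : 0 < 1 / w ^ 2 := by positivity
    have h8 : ε * k / w ^ 2 * Real.exp (-ε * k) ≤ 1 / w ^ 2 := by
      rw [div_mul_eq_mul_div]; gcongr
    have h9 : 0 ≤ ε * k / w ^ 2 * Real.exp (-ε * k) := by positivity
    have h10 : (4 : ℝ) / w ^ 2 = 4 * (1 / w ^ 2) := by ring
    have h11 : (2 : ℝ) / w ^ 2 = 2 * (1 / w ^ 2) := by ring
    rw [abs_le]
    constructor <;> nlinarith [mul_nonneg h7.le h1.le, mul_nonneg h6 h1.le]
  have hS : |Real.sin (2 * w * s) / (2 * s)| ≤ Real.sqrt (2 * w * s) / (2 * s) := by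
    rw [abs_div, abs_of_pos (by positivity : 0 < 2 * s)]
    gcongr
    exact abs_sin_le_sqrt (by positivity)
  have h2 : Real.sqrt (2 * w * s) / (2 * s) * (4 / w ^ 2) ≤
      4 * s ^ (-(1 / 2) : ℝ) * w ^ (-(3 / 2) : ℝ) := by
    have hs' : s ^ (-(1 / 2) : ℝ) = Real.sqrt s / s := by
      rw [Real.rpow_neg hs.le, ← Real.sqrt_eq_rpow, eq_div_iff hs.ne', inv_mul_eq_iff_eq_mul₀
        (Real.sqrt_pos.2 hs).ne', Real.mul_self_sqrt hs.le]
    have hw' : w ^ (-(3 / 2) : ℝ) = Real.sqrt w / w ^ 2 := by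
      rw [Real.sqrt_eq_rpow, ← Real.rpow_natCast w 2, ← Real.rpow_sub hf]; norm_num
    have h2' : Real.sqrt 2 ≤ 2 := by
      rw [Real.sqrt_le_left (by norm_num)]; norm_num
    rw [hs', hw', Real.sqrt_mul (by positivity), Real.sqrt_mul (by positivity)]
    have : √2 * √w * √s / (2 * s) * (4 / w ^ 2) = (√2 * 2) * (√s / s * (√w / w ^ 2)) := by
      field_simp; ring
    rw [this]
    have : 4 * (√s / s) * (√w / w ^ 2) = 4 * (√s / s * (√w / w ^ 2)) := by ring
    rw [this]
    gcongr
    linarith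
  unfold oscDensity
  rw [abs_neg, abs_mul]
  exact (mul_le_mul hS hA (abs_nonneg _) (by positivity)).trans h2

lemma integrableOn_oscDensity {μ ε s : ℝ} (hμ : 0 < μ) (hε : 0 ≤ ε) (hs : 0 < s) :
    IntegrableOn (oscDensity μ ε s) (Set.Ioi 0) := by
  refine Integrable.mono' ((integrableOn_freq_rpow hμ (r := 3 / 2) (by norm_num)).const_mul
    (4 * s ^ (-(1 / 2) : ℝ))) (continuous_oscDensity hμ ε s).aestronglyMeasurable ?_
  refine (ae_restrict_mem measurableSet_Ioi).mono fun k hk => ?_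
  exact abs_oscDensity_le hμ hε hs hk

lemma integrableOn_exp_neg_mul {ε : ℝ} (hε : 0 < ε) :
    IntegrableOn (fun k : ℝ => Real.exp (-ε * k)) (Set.Ioi 0) :=
  integrableOn_exp_mul_Ioi (by linarith) 0

lemma sq_div_freq_cube_le {μ : ℝ} (hμ : 0 < μ) (k : ℝ) : k ^ 2 / freq μ k ^ 3 ≤ 1 / μ := by
  have hf := freq_pos hμ k
  rw [div_le_div_iff₀ (by positivity) hμ]
  have h1 := le_freq_left μ k
  have h2 : k ^ 2 ≤ freq μ k ^ 2 := by nlinarith [freq_sq μ k, sq_nonneg μ]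
  calc k ^ 2 * μ ≤ freq μ k ^ 2 * freq μ k := by gcongr
    _ = 1 * freq μ k ^ 3 := by ring

lemma continuous_oscKernel_integrand {μ : ℝ} (hμ : 0 < μ) (ε : ℝ) :
    Continuous fun p : ℝ × ℝ => p.1 ^ 2 / freq μ p.1 ^ 3 * Real.cos (2 * freq μ p.1 * p.2) *
      Real.exp (-ε * p.1) := by
  have h := continuous_freq μ
  have h0 : ∀ p : ℝ × ℝ, freq μ p.1 ^ 3 ≠ 0 := fun k => pow_ne_zero _ (freq_pos hμ _).ne'
  have h1 : Continuous fun p : ℝ × ℝ => freq μ p.1 := h.comp continuous_fst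
  fun_prop (disch := assumption)

lemma abs_oscKernel_integrand_le {μ : ℝ} (hμ : 0 < μ) (ε s k : ℝ) :
    |k ^ 2 / freq μ k ^ 3 * Real.cos (2 * freq μ k * s) * Real.exp (-ε * k)| ≤
      1 / μ * Real.exp (-ε * k) := by
  have hf := freq_pos hμ k
  rw [abs_mul, abs_mul, Real.abs_exp, abs_of_nonneg (by positivity : 0 ≤ k ^ 2 / freq μ k ^ 3)]
  gcongr
  exact (mul_le_mul (sq_div_freq_cube_le hμ k) (Real.abs_cos_le_one _) (abs_nonneg _)
    (by positivity)).trans_eq (mul_one _)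

lemma integrableOn_oscKernel_integrand {μ ε : ℝ} (hμ : 0 < μ) (hε : 0 < ε) (s : ℝ) :
    IntegrableOn (fun k => k ^ 2 / freq μ k ^ 3 * Real.cos (2 * freq μ k * s) *
      Real.exp (-ε * k)) (Set.Ioi 0) := by
  refine Integrable.mono' ((integrableOn_exp_neg_mul hε).const_mul (1 / μ)) ?_ ?_
  · exact ((continuous_oscKernel_integrand hμ ε).comp
      (by fun_prop : Continuous fun k : ℝ => (k, s))).aestronglyMeasurable
  · exact .of_forall fun k => abs_oscKernel_integrand_le hμ ε s k

/-- Integration by parts: k/ω · cos(2ωs) is the k-derivative of sin(2ωs)/(2s), and the remaining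
factor is k e^(-εk)/ω². The boundary terms vanish, at 0 by the factor k and at infinity by the
cut-off. -/
lemma oscKernel_eq {μ ε s : ℝ} (hμ : 0 < μ) (hε : 0 < ε) (hs : 0 < s) :
    oscKernel μ ε s = ∫ k in Set.Ioi (0 : ℝ), oscDensity μ ε s k := by
  set f : ℝ → ℝ := fun k =>
    k / freq μ k ^ 2 * Real.exp (-ε * k) * (Real.sin (2 * freq μ k * s) / (2 * s)) with hfdef
  have hd : ∀ k ∈ Set.Ici (0 : ℝ), HasDerivAt f
      (k ^ 2 / freq μ k ^ 3 * Real.cos (2 * freq μ k * s) * Real.exp (-ε * k) -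
        oscDensity μ ε s k) k := by
    intro k _
    have hf := freq_pos hμ k
    have h1 := hasDerivAt_freq hμ k
    have h2 : HasDerivAt (fun k => Real.exp (-ε * k)) (Real.exp (-ε * k) * (-ε)) k := by
      simpa using ((hasDerivAt_id k).const_mul (-ε)).exp
    have h3 := (((h1.const_mul 2).mul_const s).sin).div_const (2 * s)
    have h4 := (((hasDerivAt_id k).div (h1.pow 2) (pow_ne_zero 2 hf.ne')).mul h2).mul h3
    refine h4.congr_deriv ?_
    simp only [oscDensity, id, Pi.div_apply, Pi.mul_apply, Pi.pow_apply]
    push_cast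
    field_simp
    ring
  have hlim : Tendsto f atTop (𝓝 0) := by
    have hb : ∀ᶠ k in atTop, ‖f k‖ ≤ (1 / (2 * s * μ)) * Real.exp (-ε * k) := by
      filter_upwards [eventually_gt_atTop 0] with k hk
      have hf := freq_pos hμ k
      rw [hfdef]
      simp only [norm_mul, Real.norm_eq_abs, Real.abs_exp, abs_div,
        abs_of_pos hk, abs_of_pos hf, abs_pow,
        abs_of_pos (by positivity : 0 < 2 * s)]
      have h1 : k / freq μ k ^ 2 ≤ 1 / μ := by
        rw [div_le_div_iff₀ (by positivity) hμ, one_mul, sq]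
        exact mul_le_mul (le_freq_right μ k) (le_freq_left μ k) hμ.le hf.le
      calc k / freq μ k ^ 2 * Real.exp (-ε * k) * (|Real.sin (2 * freq μ k * s)| / (2 * s))
          ≤ 1 / μ * Real.exp (-ε * k) * (1 / (2 * s)) := by
            have h2 := Real.abs_sin_le_one (2 * freq μ k * s)
            gcongr
        _ = 1 / (2 * s * μ) * Real.exp (-ε * k) := by ring
    refine squeeze_zero_norm' hb ?_
    have h1 : Tendsto (fun k => -ε * k) atTop atBot :=
      tendsto_id.const_mul_atTop_of_neg (by linarith)
    simpa using (Real.tendsto_exp_atBot.comp h1).const_mul (1 / (2 * s * μ))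
  have hi := integrableOn_oscKernel_integrand hμ hε s
  have hj := integrableOn_oscDensity hμ hε.le hs
  have h := integral_Ioi_of_hasDerivAt_of_tendsto' hd (hi.sub hj) hlim
  rw [integral_sub hi hj] at h
  have h0 : f 0 = 0 := by simp [hfdef]
  rw [h0, sub_zero, sub_eq_zero] at h
  exact h

/-- The total mass of the dominating function in the estimate of the kernel. -/
def oscBound (μ : ℝ) : ℝ := 4 * ∫ k in Set.Ioi (0 : ℝ), freq μ k ^ (-(3 / 2) : ℝ)

lemma oscBound_nonneg (μ : ℝ) : 0 ≤ oscBound μ :=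
  mul_nonneg (by norm_num) (integral_nonneg fun k => Real.rpow_nonneg (freq_nonneg μ k) _)

/-- The kernel of the first order contribution, without cut-off. -/
def limitKernel (μ s : ℝ) : ℝ := ∫ k in Set.Ioi (0 : ℝ), oscDensity μ 0 s k

lemma abs_integral_oscDensity_le {μ ε s : ℝ} (hμ : 0 < μ) (hε : 0 ≤ ε) (hs : 0 < s) :
    |∫ k in Set.Ioi (0 : ℝ), oscDensity μ ε s k| ≤ oscBound μ * s ^ (-(1 / 2) : ℝ) := by
  have h := norm_integral_le_of_norm_le (f := oscDensity μ ε s)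
    ((integrableOn_freq_rpow hμ (r := 3 / 2) (by norm_num)).const_mul (4 * s ^ (-(1 / 2) : ℝ)))
    ((ae_restrict_mem measurableSet_Ioi).mono fun k hk => abs_oscDensity_le hμ hε hs hk)
  rw [integral_const_mul] at h
  refine h.trans (le_of_eq ?_)
  unfold oscBound
  ring

/-- Only after the integration by parts is there a dominating function independent of ε. -/
lemma tendsto_oscKernel {μ s : ℝ} (hμ : 0 < μ) (hs : 0 < s) :
    Tendsto (fun ε => oscKernel μ ε s) (𝓝[>] 0) (𝓝 (limitKernel μ s)) := by
  have h : Tendsto (fun ε => ∫ k in Set.Ioi (0 : ℝ), oscDensity μ ε s k) (𝓝[>] 0)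
      (𝓝 (limitKernel μ s)) := by
    refine tendsto_integral_filter_of_dominated_convergence
      (fun k => 4 * s ^ (-(1 / 2) : ℝ) * freq μ k ^ (-(3 / 2) : ℝ)) ?_ ?_ ?_ ?_
    · exact .of_forall fun ε => (continuous_oscDensity hμ ε s).aestronglyMeasurable
    · filter_upwards [self_mem_nhdsWithin] with ε hε
      exact (ae_restrict_mem measurableSet_Ioi).mono fun k hk =>
        abs_oscDensity_le hμ (le_of_lt hε) hs hk
    · exact (integrableOn_freq_rpow hμ (r := 3 / 2) (by norm_num)).const_mul _
    · refine .of_forall fun k => ?_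
      have : Continuous fun ε => oscDensity μ ε s k := by unfold oscDensity; fun_prop
      exact (this.tendsto 0).mono_left nhdsWithin_le_nhds
  refine h.congr' ?_
  filter_upwards [self_mem_nhdsWithin] with ε hε
  exact (oscKernel_eq hμ hε hs).symm

lemma abs_oscKernel_le {μ ε s : ℝ} (hμ : 0 < μ) (hε : 0 < ε) (hs : 0 < s) :
    |oscKernel μ ε s| ≤ oscBound μ * s ^ (-(1 / 2) : ℝ) := by
  rw [oscKernel_eq hμ hε hs]; exact abs_integral_oscDensity_le hμ hε.le hs

lemma continuous_oscKernel {μ ε : ℝ} (hμ : 0 < μ) (hε : 0 < ε) : Continuous (oscKernel μ ε) := by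
  refine continuous_of_dominated (bound := fun k => 1 / μ * Real.exp (-ε * k)) ?_ ?_ ?_ ?_
  · exact fun s => (integrableOn_oscKernel_integrand hμ hε s).aestronglyMeasurable
  · exact fun s => .of_forall fun k => abs_oscKernel_integrand_le hμ ε s k
  · exact (integrableOn_exp_neg_mul hε).const_mul (1 / μ)
  · exact .of_forall fun k => by fun_prop

/-! ### Dyson series and the mode equation -/

/-- The terms of the Dyson series of the mode equation `χ'' + (ω² + V) χ = 0`. -/
def dysonTerm (ω τ₀ : ℝ) (V : ℝ → ℝ) : ℕ → ℝ → ℂ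
  | 0, τ => ((1 / Real.sqrt (2 * ω) : ℝ) : ℂ) * Complex.exp (Complex.I * ((ω * τ : ℝ) : ℂ))
  | n + 1, τ => ∫ η in τ₀..τ,
      ((Real.sin (ω * (η - τ)) / ω * V η : ℝ) : ℂ) * dysonTerm ω τ₀ V n η

lemma dysonTerm_zero (ω τ₀ : ℝ) (V : ℝ → ℝ) (τ : ℝ) : dysonTerm ω τ₀ V 0 τ =
    ((1 / Real.sqrt (2 * ω) : ℝ) : ℂ) * Complex.exp (Complex.I * ((ω * τ : ℝ) : ℂ)) := rfl

lemma dysonTerm_succ (ω τ₀ : ℝ) (V : ℝ → ℝ) (n : ℕ) (τ : ℝ) : dysonTerm ω τ₀ V (n + 1) τ =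
    ∫ η in τ₀..τ, ((Real.sin (ω * (η - τ)) / ω * V η : ℝ) : ℂ) * dysonTerm ω τ₀ V n η := rfl

attribute [irreducible] dysonTerm

/-- The sum of the Dyson series. -/
def dysonMode (ω τ₀ : ℝ) (V : ℝ → ℝ) (τ : ℝ) : ℂ := ∑' n : ℕ, dysonTerm ω τ₀ V n τ

/-- Joint continuity in parameter and time is what the induction needs, time being both a parameter
and a limit of integration; it also yields measurability in k. -/
lemma continuous_dysonTerm_param {X : Type*} [TopologicalSpace X]
    [FirstCountableTopology X] {ω : X → ℝ} (hω : Continuous ω)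
    (hpos : ∀ x, 0 < ω x) (τ₀ : ℝ) {V : ℝ → ℝ} (hV : Continuous V) (n : ℕ) :
    Continuous fun p : X × ℝ => dysonTerm (ω p.1) τ₀ V n p.2 := by
  have hne : ∀ p : X × ℝ, ω p.1 ≠ 0 := fun p => (hpos p.1).ne'
  have hω1 : Continuous fun p : X × ℝ => ω p.1 := hω.comp continuous_fst
  induction n with
  | zero =>
    simp only [dysonTerm_zero]
    have h2 : ∀ p : X × ℝ, Real.sqrt (2 * ω p.1) ≠ 0 := fun p =>
      (Real.sqrt_pos.2 (by have := hpos p.1; linarith)).ne'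
    fun_prop (disch := assumption)
  | succ n ih =>
    simp only [dysonTerm_succ]
    have h3 : Continuous fun q : (X × ℝ) × ℝ => dysonTerm (ω q.1.1) τ₀ V n q.2 :=
      ih.comp ((continuous_fst.comp continuous_fst).prodMk continuous_snd)
    have h4 : ∀ q : (X × ℝ) × ℝ, ω q.1.1 ≠ 0 := fun q => (hpos q.1.1).ne'
    have h5 : Continuous fun q : (X × ℝ) × ℝ => ω q.1.1 := hω1.comp continuous_fst
    have h6 : Continuous fun q : (X × ℝ) × ℝ =>
        ((Real.sin (ω q.1.1 * (q.2 - q.1.2)) / ω q.1.1 * V q.2 : ℝ) : ℂ) := by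
      fun_prop (disch := assumption)
    exact intervalIntegral.continuous_parametric_intervalIntegral_of_continuous
      (f := fun (p : X × ℝ) η => ((Real.sin (ω p.1 * (η - p.2)) / ω p.1 * V η : ℝ) : ℂ) *
        dysonTerm (ω p.1) τ₀ V n η) (h6.mul h3) continuous_snd

lemma continuous_dysonTerm {ω : ℝ} (hω : 0 < ω) (τ₀ : ℝ) {V : ℝ → ℝ} (hV : Continuous V) (n : ℕ) :
    Continuous (dysonTerm ω τ₀ V n) :=
  (continuous_dysonTerm_param (X := Unit) (ω := fun _ => ω) continuous_const (fun _ => hω) τ₀ hV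
    n).comp (by fun_prop : Continuous fun τ : ℝ => ((), τ))

/-- Each iteration contributes a factor M/ω and one more integration in time, whence the factorial.
-/
lemma norm_dysonTerm_le {ω τ₀ T M : ℝ} (hω : 0 < ω) {V : ℝ → ℝ} (hV : Continuous V)
    (hM : ∀ τ ∈ Set.Icc τ₀ T, |V τ| ≤ M) (n : ℕ) :
    ∀ τ ∈ Set.Icc τ₀ T, ‖dysonTerm ω τ₀ V n τ‖ ≤
      1 / Real.sqrt (2 * ω) * ((M / ω) ^ n * (τ - τ₀) ^ n / n.factorial) := by
  induction n with
  | zero =>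
    intro τ _
    simp only [dysonTerm_zero, pow_zero, Nat.factorial_zero, Nat.cast_one, norm_mul]
    rw [mul_comm Complex.I, Complex.norm_exp_ofReal_mul_I, Complex.norm_real,
      Real.norm_of_nonneg (by positivity)]
    simp
  | succ n ih =>
    intro τ hτ
    have hM0 : 0 ≤ M := (abs_nonneg _).trans (hM τ hτ)
    have hcont := continuous_dysonTerm hω τ₀ hV n
    have hb : ‖dysonTerm ω τ₀ V (n + 1) τ‖ ≤ ∫ η in τ₀..τ,
        M / ω * (1 / Real.sqrt (2 * ω) * ((M / ω) ^ n * (η - τ₀) ^ n / n.factorial)) := by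
      simp only [dysonTerm_succ]
      refine intervalIntegral.norm_integral_le_of_norm_le hτ.1 (.of_forall fun η hη => ?_)
        (Continuous.intervalIntegrable (by fun_prop) _ _)
      have hη' : η ∈ Set.Icc τ₀ T := ⟨hη.1.le, hη.2.trans hτ.2⟩
      rw [norm_mul, Complex.norm_real, Real.norm_eq_abs, abs_mul, abs_div, abs_of_pos hω]
      refine mul_le_mul ?_ (ih η hη') (norm_nonneg _) (by positivity)
      rw [div_mul_eq_mul_div]
      gcongr
      calc _ ≤ 1 * M := mul_le_mul (Real.abs_sin_le_one _) (hM η hη') (abs_nonneg _) zero_le_one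
        _ = M := one_mul _
    refine hb.trans (le_of_eq ?_)
    have h1 : ∫ η in τ₀..τ, (η - τ₀) ^ n = (τ - τ₀) ^ (n + 1) / (n + 1) := by
      rw [intervalIntegral.integral_comp_sub_right (fun x => x ^ n)]; simp
    have h2 : ∀ η : ℝ, M / ω * (1 / Real.sqrt (2 * ω) * ((M / ω) ^ n * (η - τ₀) ^ n / n.factorial)) =
        M / ω * (1 / Real.sqrt (2 * ω)) * ((M / ω) ^ n / n.factorial) * (η - τ₀) ^ n := by
      intro η; ring
    simp only [h2]
    rw [intervalIntegral.integral_const_mul, h1, Nat.factorial_succ]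
    push_cast
    rw [pow_succ (M / ω) n]
    field_simp

lemma norm_dysonTerm_le_const {ω τ₀ T M : ℝ} (hω : 0 < ω) {V : ℝ → ℝ} (hV : Continuous V)
    (hM : ∀ τ ∈ Set.Icc τ₀ T, |V τ| ≤ M) (n : ℕ) {τ : ℝ} (hτ : τ ∈ Set.Icc τ₀ T) :
    ‖dysonTerm ω τ₀ V n τ‖ ≤
      1 / Real.sqrt (2 * ω) * ((M / ω * (T - τ₀)) ^ n / n.factorial) := by
  refine (norm_dysonTerm_le hω hV hM n τ hτ).trans ?_
  have hM0 : 0 ≤ M := (abs_nonneg _).trans (hM τ hτ)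
  have h1 : 0 ≤ τ - τ₀ := sub_nonneg.2 hτ.1
  rw [mul_pow]
  gcongr
  exact hτ.2

lemma exists_abs_le_of_continuous {V : ℝ → ℝ} (hV : Continuous V) (τ₀ T : ℝ) :
    ∃ M, ∀ τ ∈ Set.Icc τ₀ T, |V τ| ≤ M :=
  isCompact_Icc.exists_bound_of_continuousOn hV.continuousOn

lemma summable_dysonTerm {ω τ₀ τ : ℝ} (hω : 0 < ω) {V : ℝ → ℝ} (hV : Continuous V) (hτ : τ₀ ≤ τ) :
    Summable fun n => dysonTerm ω τ₀ V n τ := by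
  obtain ⟨M, hM⟩ := exists_abs_le_of_continuous hV τ₀ τ
  exact Summable.of_norm_bounded ((Real.summable_pow_div_factorial _).mul_left _)
    fun n => norm_dysonTerm_le_const hω hV hM n ⟨hτ, le_rfl⟩

lemma continuousOn_dysonMode {ω τ₀ : ℝ} (hω : 0 < ω) {V : ℝ → ℝ} (hV : Continuous V) (T : ℝ) :
    ContinuousOn (dysonMode ω τ₀ V) (Set.Icc τ₀ T) := by
  obtain ⟨M, hM⟩ := exists_abs_le_of_continuous hV τ₀ T
  exact continuousOn_tsum (fun n => (continuous_dysonTerm hω τ₀ hV n).continuousOn)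
    ((Real.summable_pow_div_factorial (M / ω * (T - τ₀))).mul_left (1 / Real.sqrt (2 * ω)))
    fun n τ hτ => norm_dysonTerm_le_const hω hV hM n hτ

/-- The Volterra equation satisfied by the mode. -/
lemma dysonMode_eq {ω τ₀ τ : ℝ} (hω : 0 < ω) {V : ℝ → ℝ} (hV : Continuous V) (hτ : τ₀ ≤ τ) :
    dysonMode ω τ₀ V τ = dysonTerm ω τ₀ V 0 τ + ∫ η in τ₀..τ,
      ((Real.sin (ω * (η - τ)) / ω * V η : ℝ) : ℂ) * dysonMode ω τ₀ V η := by
  obtain ⟨M, hM⟩ := exists_abs_le_of_continuous hV τ₀ τ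
  have hM0 : 0 ≤ M := (abs_nonneg _).trans (hM τ ⟨hτ, le_rfl⟩)
  rw [dysonMode, (summable_dysonTerm hω hV hτ).tsum_eq_zero_add]
  congr 1
  simp only [dysonTerm_succ]
  set C : ℝ := 1 / Real.sqrt (2 * ω) with hC
  have hs : Summable fun n : ℕ => 1 / ω * M * (C * ((M / ω * (τ - τ₀)) ^ n / n.factorial)) :=
    ((Real.summable_pow_div_factorial (M / ω * (τ - τ₀))).mul_left C).mul_left (1 / ω * M)
  have hsum : HasSum (fun n => ∫ η in τ₀..τ,
      ((Real.sin (ω * (η - τ)) / ω * V η : ℝ) : ℂ) * dysonTerm ω τ₀ V n η)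
      (∫ η in τ₀..τ, ((Real.sin (ω * (η - τ)) / ω * V η : ℝ) : ℂ) * dysonMode ω τ₀ V η) := by
    refine intervalIntegral.hasSum_integral_of_dominated_convergence
      (fun n _ => 1 / ω * M * (C * ((M / ω * (τ - τ₀)) ^ n / n.factorial)))
      (fun n => ?_) (fun n => .of_forall fun η hη => ?_) (.of_forall fun _ _ => hs)
      intervalIntegrable_const (.of_forall fun η hη => ?_)
    · have := continuous_dysonTerm hω τ₀ hV n
      exact Continuous.aestronglyMeasurable (by fun_prop)
    · rw [Set.uIoc_of_le hτ] at hη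
      have hη' : η ∈ Set.Icc τ₀ τ := ⟨hη.1.le, hη.2⟩
      have h1 := norm_dysonTerm_le_const hω hV hM n hη'
      have h2 : ‖((Real.sin (ω * (η - τ)) / ω * V η : ℝ) : ℂ)‖ ≤ 1 / ω * M := by
        rw [Complex.norm_real, Real.norm_eq_abs, abs_mul, abs_div, abs_of_pos hω]
        have := Real.abs_sin_le_one (ω * (η - τ))
        have := hM η hη'
        gcongr
      rw [norm_mul]
      exact mul_le_mul h2 h1 (norm_nonneg _) (by positivity)
    · rw [Set.uIoc_of_le hτ] at hη
      exact (summable_dysonTerm hω hV hη.1.le).hasSum.mul_left _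
  exact hsum.tsum_eq

lemma continuous_dysonMode_max {ω τ₀ : ℝ} (hω : 0 < ω) {V : ℝ → ℝ} (hV : Continuous V) :
    Continuous fun τ => dysonMode ω τ₀ V (max τ τ₀) := by
  have h : ContinuousOn (dysonMode ω τ₀ V) (Set.Ici τ₀) := by
    intro τ hτ
    refine (continuousOn_dysonMode hω hV (τ + 1) τ ⟨hτ, by linarith⟩).mono_of_mem_nhdsWithin ?_
    filter_upwards [self_mem_nhdsWithin, mem_nhdsWithin_of_mem_nhds (Iio_mem_nhds (lt_add_one τ))]
      with x hx hx'
    exact ⟨hx, le_of_lt hx'⟩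
  exact h.comp_continuous (by fun_prop) fun τ => Set.mem_Ici.2 (le_max_right _ _)

/-- The mode solves `χ'' = -(ω² + V) χ` with positive frequency initial data. -/
lemma exists_dysonMode_ode {ω τ₀ : ℝ} (hω : 0 < ω) {V : ℝ → ℝ} (hV : Continuous V) :
    ∃ Y Z : ℝ → ℂ, (∀ τ, HasDerivAt Y (Z τ) τ) ∧ Continuous Z ∧
      (∀ τ, τ₀ ≤ τ → HasDerivAt Z (-((ω ^ 2 + V τ : ℝ) : ℂ) * Y τ) τ) ∧
      (∀ τ, τ₀ ≤ τ → Y τ = (Real.sqrt (2 * ω) : ℂ) * dysonMode ω τ₀ V τ) ∧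
      Y τ₀ = Complex.exp (Complex.I * ((ω * τ₀ : ℝ) : ℂ)) ∧
      Z τ₀ = Complex.I * ω * Complex.exp (Complex.I * ((ω * τ₀ : ℝ) : ℂ)) := by
  -- The series is controlled only for τ ≥ τ₀; the maximum extends the mode continuously to the
  -- whole line.
  set w : ℝ → ℂ := fun τ => (Real.sqrt (2 * ω) : ℂ) * dysonMode ω τ₀ V (max τ τ₀) with hw
  have hwc : Continuous w := continuous_const.mul (continuous_dysonMode_max hω hV)
  set A : ℝ → ℂ := fun τ => ∫ η in τ₀..τ, ((Real.sin (ω * η) * V η : ℝ) : ℂ) * w η with hA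
  set B : ℝ → ℂ := fun τ => ∫ η in τ₀..τ, ((Real.cos (ω * η) * V η : ℝ) : ℂ) * w η with hB
  have hAc : Continuous fun η => ((Real.sin (ω * η) * V η : ℝ) : ℂ) * w η := by fun_prop
  have hBc : Continuous fun η => ((Real.cos (ω * η) * V η : ℝ) : ℂ) * w η := by fun_prop
  have hA' : ∀ τ, HasDerivAt A (((Real.sin (ω * τ) * V τ : ℝ) : ℂ) * w τ) τ := fun τ =>
    intervalIntegral.integral_hasDerivAt_right (hAc.intervalIntegrable _ _)
      hAc.stronglyMeasurable.stronglyMeasurableAtFilter hAc.continuousAt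
  have hB' : ∀ τ, HasDerivAt B (((Real.cos (ω * τ) * V τ : ℝ) : ℂ) * w τ) τ := fun τ =>
    intervalIntegral.integral_hasDerivAt_right (hBc.intervalIntegrable _ _)
      hBc.stronglyMeasurable.stronglyMeasurableAtFilter hBc.continuousAt
  have hlin : ∀ τ, HasDerivAt (fun τ : ℝ => ω * τ) ω τ := fun τ => by
    simpa using (hasDerivAt_id τ).const_mul ω
  have hsin : ∀ τ, HasDerivAt (fun τ : ℝ => ((Real.sin (ω * τ) : ℝ) : ℂ))
      ((Real.cos (ω * τ) * ω : ℝ) : ℂ) τ := fun τ => (hlin τ).sin.ofReal_comp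
  have hcos : ∀ τ, HasDerivAt (fun τ : ℝ => ((Real.cos (ω * τ) : ℝ) : ℂ))
      ((-Real.sin (ω * τ) * ω : ℝ) : ℂ) τ := fun τ => (hlin τ).cos.ofReal_comp
  have hexp : ∀ τ, HasDerivAt (fun τ : ℝ => Complex.exp (Complex.I * ((ω * τ : ℝ) : ℂ)))
      (Complex.I * ω * Complex.exp (Complex.I * ((ω * τ : ℝ) : ℂ))) τ := fun τ =>
    (((hlin τ).ofReal_comp.const_mul Complex.I).cexp).congr_deriv (by ring)
  have hωC : (ω : ℂ) ≠ 0 := by exact_mod_cast hω.ne'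
  -- Variation of constants: the addition theorem for sin(ω(η-τ)) moves τ out of the integrals. In
  -- Y' the contributions of A' and B' cancel, so that Y' = Z.
  set Y : ℝ → ℂ := fun τ => Complex.exp (Complex.I * ((ω * τ : ℝ) : ℂ)) +
    (1 / ω : ℂ) * ((Real.cos (ω * τ) : ℂ) * A τ - (Real.sin (ω * τ) : ℂ) * B τ) with hY
  set Z : ℝ → ℂ := fun τ => Complex.I * ω * Complex.exp (Complex.I * ((ω * τ : ℝ) : ℂ)) -
    ((Real.sin (ω * τ) : ℂ) * A τ + (Real.cos (ω * τ) : ℂ) * B τ) with hZ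
  have hYw : ∀ τ, τ₀ ≤ τ → Y τ = (Real.sqrt (2 * ω) : ℂ) * dysonMode ω τ₀ V τ := by
    intro τ hτ
    have hs : (Real.sqrt (2 * ω) : ℂ) ≠ 0 := by
      exact_mod_cast (Real.sqrt_pos.2 (by linarith : 0 < 2 * ω)).ne'
    rw [dysonMode_eq hω hV hτ, mul_add, dysonTerm_zero, ← mul_assoc]
    have h1 : (Real.sqrt (2 * ω) : ℂ) * ((1 / Real.sqrt (2 * ω) : ℝ) : ℂ) = 1 := by
      push_cast; field_simp
    rw [h1, one_mul]
    simp only [hY]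
    congr 1
    simp only [hA, hB]
    rw [← intervalIntegral.integral_const_mul, ← intervalIntegral.integral_const_mul,
      ← intervalIntegral.integral_sub, ← intervalIntegral.integral_const_mul,
      ← intervalIntegral.integral_const_mul]
    · refine intervalIntegral.integral_congr fun η hη => ?_
      rw [Set.uIcc_of_le hτ] at hη
      simp only [hw, max_eq_left hη.1]
      have h2 : Real.sin (ω * (η - τ)) = Real.sin (ω * η) * Real.cos (ω * τ) -
          Real.cos (ω * η) * Real.sin (ω * τ) := by
        rw [mul_sub, Real.sin_sub]
      rw [h2]
      push_cast
      field_simp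
    · exact (continuous_const.mul hAc).intervalIntegrable _ _
    · exact (continuous_const.mul hBc).intervalIntegrable _ _
  have hZ' : ∀ τ, HasDerivAt Z (-((ω ^ 2 : ℝ) : ℂ) * Y τ - (V τ : ℂ) * w τ) τ := by
    intro τ
    refine (((hexp τ).const_mul (Complex.I * ω)).sub
      (((hsin τ).mul (hA' τ)).add ((hcos τ).mul (hB' τ)))).congr_deriv ?_
    have h1 : (Real.sin (ω * τ) : ℂ) ^ 2 + (Real.cos (ω * τ) : ℂ) ^ 2 = 1 := by
      exact_mod_cast Real.sin_sq_add_cos_sq (ω * τ)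
    rw [hY]
    push_cast
    push_cast at h1
    generalize Complex.exp (Complex.I * (ω * τ)) = E
    field_simp
    linear_combination (ω : ℂ) ^ 2 * E * Complex.I_sq -
      V τ * w τ * h1
  refine ⟨Y, Z, fun τ => ?_, continuous_iff_continuousAt.2 fun τ => (hZ' τ).continuousAt,
    fun τ hτ => ?_, hYw, by simp [hY, hA, hB], by simp [hZ, hA, hB]⟩
  · refine ((hexp τ).add ((((hcos τ).mul (hA' τ)).sub
      ((hsin τ).mul (hB' τ))).const_mul (1 / ω : ℂ))).congr_deriv ?_
    rw [hZ]
    push_cast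
    field_simp
    ring
  · refine (hZ' τ).congr_deriv ?_
    have : w τ = Y τ := by rw [hYw τ hτ, hw]; simp [max_eq_left hτ]
    rw [this]
    push_cast
    ring

/-! ### Volterra equation for the squared modulus of a mode -/

/-- The kernel of the Volterra equation satisfied by the nonlinear part of the source of
the squared modulus of a mode. -/
def responseKernel (ω : ℝ) (V v : ℝ → ℝ) (τ η : ℝ) : ℝ :=
  -(4 * V τ * (Real.sin (2 * ω * (τ - η)) / (2 * ω))) -
    2 * v τ * ((1 - Real.cos (2 * ω * (τ - η))) / (4 * ω ^ 2))

/-- The squared modulus of a mode, in terms of the solution of a real Volterra equation. -/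
lemma exists_response {ω τ₀ : ℝ} (hω : 0 < ω) {V v : ℝ → ℝ} (hv : Continuous v)
    (hVv : ∀ τ, HasDerivAt V (v τ) τ) (hV0 : V τ₀ = 0) :
    ∃ F : ℝ → ℝ, Continuous F ∧ ∀ τ, τ₀ ≤ τ →
      F τ = (∫ η in τ₀..τ, responseKernel ω V v τ η * (F η - 2 * v η)) ∧
      2 * ω * ‖dysonMode ω τ₀ V τ‖ ^ 2 - 1 =
        ∫ η in τ₀..τ, (1 - Real.cos (2 * ω * (τ - η))) / (4 * ω ^ 2) * (F η - 2 * v η) := by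
  have hV : Continuous V := continuous_iff_continuousAt.2 fun τ => (hVv τ).continuousAt
  obtain ⟨Y, Z, hY, hZc, hZ, hYm, hY0, hZ0⟩ := exists_dysonMode_ode (τ₀ := τ₀) hω hV
  have hYc : Continuous Y := continuous_iff_continuousAt.2 fun τ => (hY τ).continuousAt
  have hre : ∀ {f : ℝ → ℂ} {f' : ℂ} {τ : ℝ}, HasDerivAt f f' τ →
      HasDerivAt (fun t => (f t).re) f'.re τ := fun h =>
    Complex.reCLM.hasFDerivAt.comp_hasDerivAt _ h
  have him : ∀ {f : ℝ → ℂ} {f' : ℂ} {τ : ℝ}, HasDerivAt f f' τ →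
      HasDerivAt (fun t => (f t).im) f'.im τ := fun h =>
    Complex.imCLM.hasFDerivAt.comp_hasDerivAt _ h
  -- For τ ≥ τ₀, ρ = |Y|² has the derivatives ρ' = r and ρ'' = D, and the set of quadratic
  -- quantities ρ, r, e is closed under differentiation.
  set ρ : ℝ → ℝ := fun τ => (Y τ).re * (Y τ).re + (Y τ).im * (Y τ).im with hρ
  set r : ℝ → ℝ := fun τ => 2 * ((Y τ).re * (Z τ).re + (Y τ).im * (Z τ).im) with hr
  set e : ℝ → ℝ := fun τ => (Z τ).re * (Z τ).re + (Z τ).im * (Z τ).im with he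
  set D : ℝ → ℝ := fun τ => 2 * e τ - 2 * (ω ^ 2 + V τ) * ρ τ with hD
  have hρc : Continuous ρ := by rw [hρ]; fun_prop
  have hrc : Continuous r := by rw [hr]; fun_prop
  have hρ' : ∀ τ, HasDerivAt ρ (r τ) τ := fun τ =>
    (((hre (hY τ)).mul (hre (hY τ))).add ((him (hY τ)).mul (him (hY τ)))).congr_deriv
      (by rw [hr]; ring)
  have hr' : ∀ τ, τ₀ ≤ τ → HasDerivAt r (D τ) τ := fun τ hτ =>
    ((((hre (hY τ)).mul (hre (hZ τ hτ))).add
      ((him (hY τ)).mul (him (hZ τ hτ)))).const_mul 2).congr_deriv (by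
        simp only [hD, he, hρ, Complex.mul_re, Complex.mul_im, Complex.neg_re, Complex.neg_im,
          Complex.ofReal_re, Complex.ofReal_im]
        ring)
  have he' : ∀ τ, τ₀ ≤ τ → HasDerivAt e (-(ω ^ 2 + V τ) * r τ) τ := fun τ hτ =>
    (((hre (hZ τ hτ)).mul (hre (hZ τ hτ))).add ((him (hZ τ hτ)).mul (him (hZ τ hτ)))).congr_deriv
      (by
        simp only [hr, Complex.mul_re, Complex.mul_im, Complex.neg_re, Complex.neg_im,
          Complex.ofReal_re, Complex.ofReal_im]
        ring)
  -- This is the source in ρ''' + 4ω²ρ' = S.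
  set S : ℝ → ℝ := fun τ => -4 * V τ * r τ - 2 * v τ * ρ τ with hS
  have hSc : Continuous S := by rw [hS]; fun_prop
  have hD' : ∀ τ, τ₀ ≤ τ → HasDerivAt D (-4 * ω ^ 2 * r τ + S τ) τ := fun τ hτ =>
    (((he' τ hτ).const_mul 2).sub ((((hVv τ).const_add (ω ^ 2)).const_mul 2).mul
      (hρ' τ))).congr_deriv (by simp only [hS]; ring)
  have hnE : (Complex.exp (Complex.I * ((ω * τ₀ : ℝ) : ℂ))).re ^ 2 +
      (Complex.exp (Complex.I * ((ω * τ₀ : ℝ) : ℂ))).im ^ 2 = 1 := by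
    rw [mul_comm, Complex.exp_ofReal_mul_I_re, Complex.exp_ofReal_mul_I_im]
    exact Real.cos_sq_add_sin_sq _
  have hρ0 : ρ τ₀ = 1 := by rw [← hnE]; simp only [hρ, hY0]; ring
  have hr0 : r τ₀ = 0 := by
    simp only [hr, hY0, hZ0, Complex.mul_re, Complex.mul_im, Complex.I_re, Complex.I_im,
      Complex.ofReal_re, Complex.ofReal_im]
    ring
  have hD0 : D τ₀ = 0 := by
    have h1 : e τ₀ = ω ^ 2 := by
      rw [← mul_one (ω ^ 2), ← hnE]
      simp only [he, hZ0, Complex.mul_re, Complex.mul_im, Complex.I_re, Complex.I_im,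
        Complex.ofReal_re, Complex.ofReal_im]
      ring
    simp only [hD, h1, hρ0, hV0]; ring
  have hlin : ∀ τ η : ℝ, HasDerivAt (fun η : ℝ => 2 * ω * (τ - η)) (-(2 * ω)) η := fun τ η => by
    simpa using ((hasDerivAt_id η).const_sub τ).const_mul (2 * ω)
  have hkey1 : ∀ τ, τ₀ ≤ τ → ρ τ - 1 =
      ∫ η in τ₀..τ, (1 - Real.cos (2 * ω * (τ - η))) / (4 * ω ^ 2) * S η := by
    intro τ hτ
    -- Duhamel's formula: the function of η below has derivative kernel times S. At η = τ only ρ(τ)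
    -- survives, and at η = τ₀ only ρ(τ₀) = 1.
    have h := intervalIntegral.integral_eq_sub_of_hasDerivAt (a := τ₀) (b := τ)
      (f := fun η => (1 - Real.cos (2 * ω * (τ - η))) / (4 * ω ^ 2) * D η +
        Real.sin (2 * ω * (τ - η)) / (2 * ω) * r η + ρ η)
      (f' := fun η => (1 - Real.cos (2 * ω * (τ - η))) / (4 * ω ^ 2) * S η) ?_ ?_
    · rw [h]
      simp [hr0, hD0, hρ0]
    · intro η hη
      rw [Set.uIcc_of_le hτ] at hη
      refine ((((((hlin τ η).cos.const_sub 1).div_const (4 * ω ^ 2)).mul (hD' η hη.1)).add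
        (((hlin τ η).sin.div_const (2 * ω)).mul (hr' η hη.1))).add (hρ' η)).congr_deriv ?_
      field_simp
      ring
    · exact Continuous.intervalIntegrable (by fun_prop) _ _
  have hkey2 : ∀ τ, τ₀ ≤ τ → r τ =
      ∫ η in τ₀..τ, Real.sin (2 * ω * (τ - η)) / (2 * ω) * S η := by
    intro τ hτ
    have h := intervalIntegral.integral_eq_sub_of_hasDerivAt (a := τ₀) (b := τ)
      (f := fun η => Real.sin (2 * ω * (τ - η)) / (2 * ω) * D η +
        Real.cos (2 * ω * (τ - η)) * r η)
      (f' := fun η => Real.sin (2 * ω * (τ - η)) / (2 * ω) * S η) ?_ ?_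
    · rw [h]
      simp [hr0, hD0]
    · intro η hη
      rw [Set.uIcc_of_le hτ] at hη
      refine ((((hlin τ η).sin.div_const (2 * ω)).mul (hD' η hη.1)).add
        ((hlin τ η).cos.mul (hr' η hη.1))).congr_deriv ?_
      field_simp
      ring
    · exact Continuous.intervalIntegrable (by fun_prop) _ _
  -- F is what remains of S after removing its value -2v at ρ = 1, ρ' = 0; inserting the Duhamel
  -- formulas for ρ - 1 and ρ' closes the equation for F.
  refine ⟨fun τ => S τ + 2 * v τ, by fun_prop, fun τ hτ => ⟨?_, ?_⟩⟩
  · have h1 : S τ + 2 * v τ = -(4 * V τ) * r τ + -(2 * v τ) * (ρ τ - 1) := by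
      simp only [hS]; ring
    simp only [add_sub_cancel_right]
    rw [h1, hkey1 τ hτ, hkey2 τ hτ, ← intervalIntegral.integral_const_mul,
      ← intervalIntegral.integral_const_mul, ← intervalIntegral.integral_add]
    · refine intervalIntegral.integral_congr fun η _ => ?_
      simp only [responseKernel]
      ring
    · exact Continuous.intervalIntegrable (by fun_prop) _ _
    · exact Continuous.intervalIntegrable (by fun_prop) _ _
  · simp only [add_sub_cancel_right]
    rw [← hkey1 τ hτ]
    congr 1
    have h1 : ρ τ = ‖Y τ‖ ^ 2 := by
      rw [← Complex.normSq_eq_norm_sq, Complex.normSq_apply]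
    rw [h1, hYm τ hτ, norm_mul, mul_pow, Complex.norm_real,
      Real.norm_of_nonneg (Real.sqrt_nonneg _), Real.sq_sqrt (by positivity)]

/-! ### Bounds for the response, uniform in the frequency -/

/-- Grönwall's inequality in integral form. -/
lemma le_mul_exp_of_le_add_mul_integral {f : ℝ → ℝ} (hf : Continuous f) (hf0 : ∀ t, 0 ≤ f t)
    {c K a T : ℝ} (hc : 0 ≤ c) (hK : 0 ≤ K)
    (h : ∀ t ∈ Set.Icc a T, f t ≤ c + K * ∫ s in a..t, f s) {t : ℝ} (ht : t ∈ Set.Icc a T) :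
    f t ≤ c * Real.exp (K * (t - a)) := by
  have hd : ∀ t, HasDerivAt (fun t => c + K * ∫ s in a..t, f s) (K * f t) t := fun t =>
    ((intervalIntegral.integral_hasDerivAt_right (hf.intervalIntegrable _ _)
      hf.stronglyMeasurable.stronglyMeasurableAtFilter hf.continuousAt).const_mul K).const_add c
  have hG := norm_le_gronwallBound_of_norm_deriv_right_le (a := a) (b := T) (δ := c) (K := K)
    (ε := 0) (f := fun t => c + K * ∫ s in a..t, f s) (f' := fun t => K * f t)
    (fun t _ => (hd t).continuousAt.continuousWithinAt) (fun t _ => (hd t).hasDerivWithinAt)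
    (by simp [abs_of_nonneg hc]) (fun t ht => ?_) t ht
  · rw [gronwallBound_ε0] at hG
    exact (h t ht).trans ((le_abs_self _).trans hG)
  · rw [Real.norm_of_nonneg (mul_nonneg hK (hf0 t)), add_zero]
    exact mul_le_mul_of_nonneg_left ((h t ⟨ht.1, ht.2.le⟩).trans (le_abs_self _)) hK

/-- The primitive of `v` vanishing at `τ₀`. -/
def primitive (τ₀ : ℝ) (v : ℝ → ℝ) (τ : ℝ) : ℝ := ∫ η in τ₀..τ, v η

lemma hasDerivAt_primitive {v : ℝ → ℝ} (hv : Continuous v) (τ₀ τ : ℝ) :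
    HasDerivAt (primitive τ₀ v) (v τ) τ :=
  intervalIntegral.integral_hasDerivAt_right (hv.intervalIntegrable _ _)
    hv.stronglyMeasurable.stronglyMeasurableAtFilter hv.continuousAt

lemma continuous_primitive {v : ℝ → ℝ} (hv : Continuous v) (τ₀ : ℝ) :
    Continuous (primitive τ₀ v) :=
  continuous_iff_continuousAt.2 fun τ => (hasDerivAt_primitive hv τ₀ τ).continuousAt

lemma primitive_self (τ₀ : ℝ) (v : ℝ → ℝ) : primitive τ₀ v τ₀ = 0 :=
  intervalIntegral.integral_same

lemma primitive_sub {v₁ v₂ : ℝ → ℝ} (h₁ : Continuous v₁) (h₂ : Continuous v₂) (τ₀ τ : ℝ) :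
    primitive τ₀ (fun t => v₁ t - v₂ t) τ = primitive τ₀ v₁ τ - primitive τ₀ v₂ τ :=
  intervalIntegral.integral_sub (h₁.intervalIntegrable _ _) (h₂.intervalIntegrable _ _)

lemma abs_intervalIntegral_le_mul {f : ℝ → ℝ} {a b ℓ C : ℝ} (hab : a ≤ b) (hℓ : b - a ≤ ℓ)
    (hC : 0 ≤ C) (h : ∀ t ∈ Set.Icc a b, |f t| ≤ C) : |∫ t in a..b, f t| ≤ C * ℓ := by
  have h1 := intervalIntegral.norm_integral_le_of_norm_le_const (a := a) (b := b) (f := f) (C := C)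
    fun t ht => by
      rw [Set.uIoc_of_le hab] at ht
      exact h t ⟨ht.1.le, ht.2⟩
  rw [abs_of_nonneg (sub_nonneg.2 hab)] at h1
  exact h1.trans (mul_le_mul_of_nonneg_left hℓ hC)

lemma abs_primitive_le {v : ℝ → ℝ} {τ₀ τ ℓ δ : ℝ} (hτ : τ₀ ≤ τ) (hℓ : τ - τ₀ ≤ ℓ) (hδ : 0 ≤ δ)
    (h : ∀ t ∈ Set.Icc τ₀ τ, |v t| ≤ δ) : |primitive τ₀ v τ| ≤ δ * ℓ :=
  abs_intervalIntegral_le_mul hτ hℓ hδ h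

/-- The sine term is O(1/ω) with |V| ≤ δℓ; the cosine term is O(1/ω²), and one factor 1/ω is
weakened to 1/μ. -/
lemma abs_responseKernel_le {μ ω ℓ δ τ₀ T τ η : ℝ} (hμ : 0 < μ) (hω : μ ≤ ω) (hδ : 0 ≤ δ)
    (hℓ : T - τ₀ ≤ ℓ) {v : ℝ → ℝ} (h : ∀ t ∈ Set.Icc τ₀ T, |v t| ≤ δ) (hτ : τ ∈ Set.Icc τ₀ T) :
    |responseKernel ω (primitive τ₀ v) v τ η| ≤ δ * (2 * ℓ + 1 / μ) / ω := by
  have hω0 : 0 < ω := hμ.trans_le hω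
  have hℓ0 : 0 ≤ ℓ := by linarith [hτ.1, hτ.2]
  have hV : |primitive τ₀ v τ| ≤ δ * ℓ :=
    abs_primitive_le hτ.1 (by linarith [hτ.2]) hδ fun t ht => h t ⟨ht.1, ht.2.trans hτ.2⟩
  have hv := h τ hτ
  have h1 : |4 * primitive τ₀ v τ * (Real.sin (2 * ω * (τ - η)) / (2 * ω))| ≤
      4 * (δ * ℓ) * (1 / (2 * ω)) := by
    rw [abs_mul, abs_mul, abs_div, abs_of_pos (by positivity : (0 : ℝ) < 4),
      abs_of_pos (by positivity : 0 < 2 * ω)]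
    have := Real.abs_sin_le_one (2 * ω * (τ - η))
    gcongr
  have h2 : |2 * v τ * ((1 - Real.cos (2 * ω * (τ - η))) / (4 * ω ^ 2))| ≤
      2 * δ * (2 / (4 * ω ^ 2)) := by
    have h3 : |1 - Real.cos (2 * ω * (τ - η))| ≤ 2 := by
      rw [abs_le]
      constructor <;> linarith [Real.cos_le_one (2 * ω * (τ - η)),
        Real.neg_one_le_cos (2 * ω * (τ - η))]
    rw [abs_mul, abs_mul, abs_div, abs_of_pos (by positivity : (0 : ℝ) < 2),
      abs_of_pos (by positivity : 0 < 4 * ω ^ 2)]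
    gcongr
  have h4 : 2 * δ * (2 / (4 * ω ^ 2)) ≤ δ * (1 / μ) / ω := by
    have : 2 * δ * (2 / (4 * ω ^ 2)) = δ * (1 / ω) / ω := by field_simp; ring
    rw [this]
    gcongr
  have h5 : 4 * (δ * ℓ) * (1 / (2 * ω)) = δ * (2 * ℓ) / ω := by field_simp; ring
  unfold responseKernel
  refine (abs_sub _ _).trans ?_
  rw [abs_neg]
  calc _ ≤ δ * (2 * ℓ) / ω + δ * (1 / μ) / ω := add_le_add (h1.trans h5.le) (h2.trans h4)
    _ = _ := by ring

lemma continuous_responseKernel {ω : ℝ} (V v : ℝ → ℝ) (τ : ℝ) :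
    Continuous (responseKernel ω V v τ) := by
  unfold responseKernel; fun_prop

/-- The kernel is linear in v, so the size estimate also controls differences of kernels. -/
lemma responseKernel_sub {v₁ v₂ : ℝ → ℝ} (h₁ : Continuous v₁) (h₂ : Continuous v₂)
    (ω τ₀ τ η : ℝ) :
    responseKernel ω (primitive τ₀ fun t => v₁ t - v₂ t) (fun t => v₁ t - v₂ t) τ η =
      responseKernel ω (primitive τ₀ v₁) v₁ τ η - responseKernel ω (primitive τ₀ v₂) v₂ τ η := by
  simp only [responseKernel, primitive_sub h₁ h₂]
  ring

/-- Solutions of the Volterra equation for the response are Lipschitz in the data, provided one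
of them is a priori bounded; the constants decay with the frequency. -/
lemma abs_response_sub_le {μ ω ℓ M δ B τ₀ T : ℝ} (hμ : 0 < μ) (hω : μ ≤ ω) (hδ : 0 ≤ δ)
    (hM : 0 ≤ M) (hB : 0 ≤ B) (hℓ0 : 0 ≤ ℓ) (hℓ : T - τ₀ ≤ ℓ) {v₁ v₂ F₁ F₂ : ℝ → ℝ}
    (hv₁ : Continuous v₁) (hv₂ : Continuous v₂) (hF₁ : Continuous F₁) (hF₂ : Continuous F₂)
    (hM₁ : ∀ t ∈ Set.Icc τ₀ T, |v₁ t| ≤ M) (hM₂ : ∀ t ∈ Set.Icc τ₀ T, |v₂ t| ≤ M)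
    (hd : ∀ t ∈ Set.Icc τ₀ T, |v₁ t - v₂ t| ≤ δ) (hB₂ : ∀ t ∈ Set.Icc τ₀ T, |F₂ t| ≤ B)
    (h₁ : ∀ t ∈ Set.Icc τ₀ T, F₁ t =
      ∫ η in τ₀..t, responseKernel ω (primitive τ₀ v₁) v₁ t η * (F₁ η - 2 * v₁ η))
    (h₂ : ∀ t ∈ Set.Icc τ₀ T, F₂ t =
      ∫ η in τ₀..t, responseKernel ω (primitive τ₀ v₂) v₂ t η * (F₂ η - 2 * v₂ η))
    {t : ℝ} (ht : t ∈ Set.Icc τ₀ T) :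
    |F₁ t - F₂ t| ≤ δ * ((2 * ℓ + 1 / μ) * (4 * M + B) * ℓ *
      Real.exp (M * (2 * ℓ + 1 / μ) / μ * ℓ)) / ω := by
  have hω0 : 0 < ω := hμ.trans_le hω
  set b : ℝ := 2 * ℓ + 1 / μ with hb
  have hb0 : 0 ≤ b := by positivity
  have hFc : Continuous fun t => |F₁ t - F₂ t| := by fun_prop
  have hmain : ∀ t ∈ Set.Icc τ₀ T, |F₁ t - F₂ t| ≤
      δ * b * (4 * M + B) / ω * ℓ + M * b / μ * ∫ s in τ₀..t, |F₁ s - F₂ s| := by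
    intro t ht
    have c1 := continuous_responseKernel (ω := ω) (primitive τ₀ v₁) v₁ t
    have c2 := continuous_responseKernel (ω := ω) (primitive τ₀ v₂) v₂ t
    rw [h₁ t ht, h₂ t ht, ← intervalIntegral.integral_sub
      (Continuous.intervalIntegrable (by fun_prop) _ _)
      (Continuous.intervalIntegrable (by fun_prop) _ _)]
    have hint : ∀ η ∈ Set.Icc τ₀ t,
        |responseKernel ω (primitive τ₀ v₁) v₁ t η * (F₁ η - 2 * v₁ η) -
          responseKernel ω (primitive τ₀ v₂) v₂ t η * (F₂ η - 2 * v₂ η)| ≤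
        δ * b * (4 * M + B) / ω + M * b / μ * |F₁ η - F₂ η| := by
      intro η hη
      have hη' : η ∈ Set.Icc τ₀ T := ⟨hη.1, hη.2.trans ht.2⟩
      have e : responseKernel ω (primitive τ₀ v₁) v₁ t η * (F₁ η - 2 * v₁ η) -
          responseKernel ω (primitive τ₀ v₂) v₂ t η * (F₂ η - 2 * v₂ η) =
          responseKernel ω (primitive τ₀ v₁) v₁ t η * ((F₁ η - F₂ η) - 2 * (v₁ η - v₂ η)) +
          responseKernel ω (primitive τ₀ fun t => v₁ t - v₂ t) (fun t => v₁ t - v₂ t) t η *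
            (F₂ η - 2 * v₂ η) := by
        rw [responseKernel_sub hv₁ hv₂]; ring
      have k1 := abs_responseKernel_le (η := η) hμ hω hM hℓ hM₁ ht
      have k2 := abs_responseKernel_le (η := η) hμ hω hδ hℓ hd ht
      have k3 : |(F₁ η - F₂ η) - 2 * (v₁ η - v₂ η)| ≤ |F₁ η - F₂ η| + 2 * δ := by
        refine (abs_sub _ _).trans ?_
        rw [abs_mul, abs_two]
        linarith [hd η hη']
      have k4 : |F₂ η - 2 * v₂ η| ≤ B + 2 * M := by
        refine (abs_sub _ _).trans ?_
        rw [abs_mul, abs_two]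
        linarith [hB₂ η hη', hM₂ η hη']
      rw [e]
      refine (abs_add_le _ _).trans ?_
      rw [abs_mul, abs_mul]
      -- Replacing ω by μ in the Grönwall rate makes the exponential independent of the frequency;
      -- the inhomogeneity keeps its factor 1/ω.
      have k5 : M * b / ω * |F₁ η - F₂ η| ≤ M * b / μ * |F₁ η - F₂ η| := by gcongr
      calc _ ≤ M * b / ω * (|F₁ η - F₂ η| + 2 * δ) + δ * b / ω * (B + 2 * M) := by
            gcongr
        _ = M * b / ω * |F₁ η - F₂ η| + δ * b * (4 * M + B) / ω := by ring
        _ ≤ _ := by linarith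
    rw [← Real.norm_eq_abs]
    refine (intervalIntegral.norm_integral_le_of_norm_le ht.1
      (.of_forall fun η hη => hint η ⟨hη.1.le, hη.2⟩)
      (Continuous.intervalIntegrable (by fun_prop) _ _ : IntervalIntegrable
        (fun η => δ * b * (4 * M + B) / ω + M * b / μ * |F₁ η - F₂ η|) volume τ₀ t)).trans ?_
    rw [intervalIntegral.integral_add intervalIntegrable_const
      (Continuous.intervalIntegrable (by fun_prop) _ _), intervalIntegral.integral_const_mul,
      intervalIntegral.integral_const, smul_eq_mul, mul_comm (t - τ₀)]
    gcongr
    linarith [ht.2]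
  have h := le_mul_exp_of_le_add_mul_integral hFc (fun _ => abs_nonneg _) (by positivity)
    (by positivity) hmain ht
  refine h.trans ?_
  have hexp : Real.exp (M * b / μ * (t - τ₀)) ≤ Real.exp (M * b / μ * ℓ) := by
    gcongr
    linarith [ht.2]
  calc _ ≤ δ * b * (4 * M + B) / ω * ℓ * Real.exp (M * b / μ * ℓ) := by gcongr
    _ = _ := by ring

/-- Comparison with the solution F = 0 for v = 0, taking δ = M. -/
lemma exists_response_bound {μ ℓ M : ℝ} (hμ : 0 < μ) (hM : 0 ≤ M) (hℓ0 : 0 ≤ ℓ) :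
    ∃ C, 0 ≤ C ∧ ∀ ω, μ ≤ ω → ∀ τ₀ T, T - τ₀ ≤ ℓ → ∀ v F : ℝ → ℝ, Continuous v → Continuous F →
      (∀ t ∈ Set.Icc τ₀ T, |v t| ≤ M) →
      (∀ t ∈ Set.Icc τ₀ T, F t =
        ∫ η in τ₀..t, responseKernel ω (primitive τ₀ v) v t η * (F η - 2 * v η)) →
      ∀ t ∈ Set.Icc τ₀ T, |F t| ≤ C / ω := by
  refine ⟨M * ((2 * ℓ + 1 / μ) * (4 * M + 0) * ℓ * Real.exp (M * (2 * ℓ + 1 / μ) / μ * ℓ)),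
    by positivity, fun ω hω τ₀ T hℓ v F hv hF hvM h t ht => ?_⟩
  have := abs_response_sub_le (v₂ := fun _ => 0) (F₂ := fun _ => 0) (δ := M) (B := 0) hμ hω hM hM
    le_rfl hℓ0 hℓ hv continuous_const hF continuous_const hvM (by simpa using fun _ _ _ => hM)
    (by simpa using hvM) (by simp) h (by simp) ht
  simpa using this

/-- The a priori bound just obtained, weakened from B/ω to B/μ, is what the Lipschitz estimate
requires of one of the two solutions. -/
lemma exists_response_lipschitz {μ ℓ M : ℝ} (hμ : 0 < μ) (hM : 0 ≤ M) (hℓ0 : 0 ≤ ℓ) :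
    ∃ C, 0 ≤ C ∧ ∀ ω, μ ≤ ω → ∀ τ₀ T, T - τ₀ ≤ ℓ → ∀ v₁ v₂ F₁ F₂ : ℝ → ℝ,
      Continuous v₁ → Continuous v₂ → Continuous F₁ → Continuous F₂ →
      (∀ t ∈ Set.Icc τ₀ T, |v₁ t| ≤ M) → (∀ t ∈ Set.Icc τ₀ T, |v₂ t| ≤ M) →
      (∀ t ∈ Set.Icc τ₀ T, F₁ t =
        ∫ η in τ₀..t, responseKernel ω (primitive τ₀ v₁) v₁ t η * (F₁ η - 2 * v₁ η)) →
      (∀ t ∈ Set.Icc τ₀ T, F₂ t =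
        ∫ η in τ₀..t, responseKernel ω (primitive τ₀ v₂) v₂ t η * (F₂ η - 2 * v₂ η)) →
      ∀ δ, 0 ≤ δ → (∀ t ∈ Set.Icc τ₀ T, |v₁ t - v₂ t| ≤ δ) →
      ∀ t ∈ Set.Icc τ₀ T, |F₁ t - F₂ t| ≤ δ * C / ω := by
  obtain ⟨B, hB0, hB⟩ := exists_response_bound hμ hM hℓ0
  refine ⟨(2 * ℓ + 1 / μ) * (4 * M + B / μ) * ℓ * Real.exp (M * (2 * ℓ + 1 / μ) / μ * ℓ),
    by positivity, fun ω hω τ₀ T hℓ v₁ v₂ F₁ F₂ hv₁ hv₂ hF₁ hF₂ hM₁ hM₂ h₁ h₂ δ hδ hd t ht => ?_⟩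
  refine abs_response_sub_le hμ hω hδ hM (by positivity) hℓ0 hℓ hv₁ hv₂ hF₁ hF₂ hM₁ hM₂ hd
    (fun s hs => (hB ω hω τ₀ T hℓ v₂ F₂ hv₂ hF₂ hM₂ h₂ s hs).trans ?_) h₁ h₂ ht
  gcongr

/-! ### Splitting of the mode density by order -/

/-- The subtracted density of the squared modes driven by the potential `∫ v`. -/
def modeDensity (μ τ₀ : ℝ) (v : ℝ → ℝ) (τ k : ℝ) : ℝ :=
  ‖dysonMode (freq μ k) τ₀ (primitive τ₀ v) τ‖ ^ 2 - 1 / (2 * freq μ k) +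
    primitive τ₀ v τ / (4 * freq μ k ^ 3)

/-- The first order part of `modeDensity`. -/
def firstOrderDensity (μ τ₀ : ℝ) (v : ℝ → ℝ) (τ k : ℝ) : ℝ :=
  1 / (4 * freq μ k ^ 3) * ∫ η in τ₀..τ, Real.cos (2 * freq μ k * (τ - η)) * v η

/-- The part of `modeDensity` of higher order. -/
def higherOrderDensity (μ τ₀ : ℝ) (v : ℝ → ℝ) (τ k : ℝ) : ℝ :=
  modeDensity μ τ₀ v τ k - firstOrderDensity μ τ₀ v τ k

lemma measurable_dysonMode {μ : ℝ} (hμ : 0 < μ) (τ₀ : ℝ) {V : ℝ → ℝ} (hV : Continuous V) :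
    Measurable fun p : ℝ × ℝ => dysonMode (freq μ p.1) τ₀ V (max p.2 τ₀) := by
  have h : ∀ n, Continuous fun p : ℝ × ℝ => dysonTerm (freq μ p.1) τ₀ V n (max p.2 τ₀) :=
    fun n => (continuous_dysonTerm_param (continuous_freq μ) (freq_pos hμ) τ₀ hV n).comp
      (continuous_fst.prodMk (continuous_snd.max continuous_const))
  refine measurable_of_tendsto_metrizable
    (f := fun (N : ℕ) (p : ℝ × ℝ) =>
      ∑ n ∈ Finset.range N, dysonTerm (freq μ p.1) τ₀ V n (max p.2 τ₀))
    (fun N => (continuous_finsetSum _ fun n _ => h n).measurable)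
    (tendsto_pi_nhds.2 fun p => ?_)
  exact (summable_dysonTerm (freq_pos hμ p.1) hV (le_max_right _ _)).hasSum.tendsto_sum_nat

lemma measurable_modeDensity_uncurry {μ : ℝ} (hμ : 0 < μ) (τ₀ : ℝ) {v : ℝ → ℝ}
    (hv : Continuous v) : Measurable fun p : ℝ × ℝ => modeDensity μ τ₀ v (max p.2 τ₀) p.1 := by
  have h1 := measurable_dysonMode hμ τ₀ (continuous_primitive hv τ₀)
  have h2 : Measurable fun p : ℝ × ℝ => freq μ p.1 :=
    (continuous_freq μ).measurable.comp measurable_fst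
  have h3 : Measurable fun p : ℝ × ℝ => primitive τ₀ v (max p.2 τ₀) :=
    (continuous_primitive hv τ₀).measurable.comp (measurable_snd.max measurable_const)
  unfold modeDensity
  exact ((h1.norm.pow_const 2).sub (measurable_const.div (h2.const_mul 2))).add
    (h3.div ((h2.pow_const 3).const_mul 4))

lemma measurable_modeDensity {μ τ₀ τ : ℝ} (hμ : 0 < μ) {v : ℝ → ℝ}
    (hv : Continuous v) (hτ : τ₀ ≤ τ) : Measurable (modeDensity μ τ₀ v τ) := by
  have := (measurable_modeDensity_uncurry hμ τ₀ hv).comp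
    (measurable_id.prodMk measurable_const : Measurable fun k : ℝ => (k, τ))
  simpa [Function.comp_def, max_eq_left hτ] using this

lemma continuous_firstOrderDensity {μ : ℝ} (hμ : 0 < μ) (τ₀ τ : ℝ) {v : ℝ → ℝ}
    (hv : Continuous v) : Continuous (firstOrderDensity μ τ₀ v τ) := by
  have h := continuous_freq μ
  have h3 : ∀ k, 4 * freq μ k ^ 3 ≠ 0 := fun k => by have := freq_pos hμ k; positivity
  have h4 : Continuous fun k => ∫ η in τ₀..τ, Real.cos (2 * freq μ k * (τ - η)) * v η := by
    refine intervalIntegral.continuous_parametric_intervalIntegral_of_continuous' ?_ _ _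
    have : Continuous fun p : ℝ × ℝ => freq μ p.1 := h.comp continuous_fst
    simp only [Function.uncurry_def]
    fun_prop
  unfold firstOrderDensity
  fun_prop (disch := assumption)

/-- Against k² dk this bound diverges logarithmically: it suffices with the cut-off only, and the
limit has to come from oscillations. -/
lemma abs_firstOrderDensity_le {μ τ₀ τ ℓ M k : ℝ} (hμ : 0 < μ) {v : ℝ → ℝ} (hM : 0 ≤ M)
    (hτ : τ₀ ≤ τ) (hℓ : τ - τ₀ ≤ ℓ) (h : ∀ t ∈ Set.Icc τ₀ τ, |v t| ≤ M) :
    |firstOrderDensity μ τ₀ v τ k| ≤ M * ℓ / freq μ k ^ 3 := by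
  have hf := freq_pos hμ k
  have h1 : |∫ η in τ₀..τ, Real.cos (2 * freq μ k * (τ - η)) * v η| ≤ M * ℓ := by
    refine abs_intervalIntegral_le_mul hτ hℓ hM fun t ht => ?_
    rw [abs_mul]
    exact (mul_le_mul (Real.abs_cos_le_one _) (h t ht) (abs_nonneg _) zero_le_one).trans_eq
      (one_mul M)
  have hℓ0 : 0 ≤ ℓ := by linarith
  unfold firstOrderDensity
  rw [abs_mul, abs_of_nonneg (by positivity : 0 ≤ 1 / (4 * freq μ k ^ 3))]
  calc _ ≤ 1 / (4 * freq μ k ^ 3) * (M * ℓ) := by gcongr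
    _ ≤ 1 / (1 * freq μ k ^ 3) * (M * ℓ) := by gcongr; norm_num
    _ = _ := by ring

/-- The part of higher order, through the response. -/
lemma exists_response_higherOrderDensity {μ τ₀ k : ℝ} (hμ : 0 < μ) {v : ℝ → ℝ}
    (hv : Continuous v) :
    ∃ F : ℝ → ℝ, Continuous F ∧ (∀ τ, τ₀ ≤ τ → F τ =
        ∫ η in τ₀..τ, responseKernel (freq μ k) (primitive τ₀ v) v τ η * (F η - 2 * v η)) ∧
      ∀ τ, τ₀ ≤ τ → higherOrderDensity μ τ₀ v τ k = 1 / (8 * freq μ k ^ 3) *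
        ∫ η in τ₀..τ, (1 - Real.cos (2 * freq μ k * (τ - η))) * F η := by
  have hf := freq_pos hμ k
  obtain ⟨F, hF, h⟩ := exists_response hf hv (hasDerivAt_primitive hv τ₀) (primitive_self τ₀ v)
  refine ⟨F, hF, fun τ hτ => (h τ hτ).1, fun τ hτ => ?_⟩
  have h1 := (h τ hτ).2
  set w := freq μ k with hw
  -- In the contribution of -2v, the constant 1 in 1 - cos gives the subtracted potential term and
  -- the cosine gives the first order density, so only F is left.
  have e1 : ∫ η in τ₀..τ, (1 - Real.cos (2 * w * (τ - η))) / (4 * w ^ 2) * (F η - 2 * v η) =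
      1 / (4 * w ^ 2) * (∫ η in τ₀..τ, (1 - Real.cos (2 * w * (τ - η))) * F η) -
        1 / (2 * w ^ 2) * primitive τ₀ v τ +
        1 / (2 * w ^ 2) * ∫ η in τ₀..τ, Real.cos (2 * w * (τ - η)) * v η := by
    unfold primitive
    rw [← intervalIntegral.integral_const_mul, ← intervalIntegral.integral_const_mul,
      ← intervalIntegral.integral_const_mul, ← intervalIntegral.integral_sub,
      ← intervalIntegral.integral_add]
    · refine intervalIntegral.integral_congr fun η _ => ?_
      field_simp
      ring
    all_goals exact Continuous.intervalIntegrable (by fun_prop) _ _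
  rw [e1] at h1
  unfold higherOrderDensity modeDensity firstOrderDensity
  rw [← hw]
  have h2 : ‖dysonMode w τ₀ (primitive τ₀ v) τ‖ ^ 2 = 1 / (2 * w) *
      (1 + (2 * w * ‖dysonMode w τ₀ (primitive τ₀ v) τ‖ ^ 2 - 1)) := by
    field_simp; ring
  rw [h2, h1]
  field_simp
  ring

lemma abs_one_sub_cos_le (x : ℝ) : |1 - Real.cos x| ≤ 2 := by
  rw [abs_le]
  constructor <;> linarith [Real.cos_le_one x, Real.neg_one_le_cos x]

/-- Three powers of the frequency come from the prefactor, the fourth from the response. -/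
lemma exists_higherOrderDensity_lipschitz {μ ℓ M : ℝ} (hμ : 0 < μ) (hM : 0 ≤ M) (hℓ0 : 0 ≤ ℓ) :
    ∃ C, 0 ≤ C ∧ ∀ τ₀ τ, τ₀ ≤ τ → τ - τ₀ ≤ ℓ → ∀ v₁ v₂ : ℝ → ℝ,
      Continuous v₁ → Continuous v₂ →
      (∀ t ∈ Set.Icc τ₀ τ, |v₁ t| ≤ M) → (∀ t ∈ Set.Icc τ₀ τ, |v₂ t| ≤ M) →
      ∀ δ, 0 ≤ δ → (∀ t ∈ Set.Icc τ₀ τ, |v₁ t - v₂ t| ≤ δ) →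
      ∀ k, |higherOrderDensity μ τ₀ v₁ τ k - higherOrderDensity μ τ₀ v₂ τ k| ≤
        δ * C / freq μ k ^ 4 := by
  obtain ⟨C, hC0, hC⟩ := exists_response_lipschitz hμ hM hℓ0
  refine ⟨C * ℓ, by positivity, fun τ₀ τ hτ hℓ v₁ v₂ hv₁ hv₂ hM₁ hM₂ δ hδ hd k => ?_⟩
  have hf := freq_pos hμ k
  obtain ⟨F₁, hF₁, e₁, r₁⟩ := exists_response_higherOrderDensity (τ₀ := τ₀) (k := k) hμ hv₁
  obtain ⟨F₂, hF₂, e₂, r₂⟩ := exists_response_higherOrderDensity (τ₀ := τ₀) (k := k) hμ hv₂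
  have h := hC (freq μ k) (le_freq_left μ k) τ₀ τ hℓ v₁ v₂ F₁ F₂ hv₁ hv₂ hF₁ hF₂ hM₁ hM₂
    (fun t ht => e₁ t ht.1) (fun t ht => e₂ t ht.1) δ hδ hd
  rw [r₁ τ hτ, r₂ τ hτ, ← mul_sub, ← intervalIntegral.integral_sub
    (Continuous.intervalIntegrable (by fun_prop) _ _)
    (Continuous.intervalIntegrable (by fun_prop) _ _), abs_mul,
    abs_of_nonneg (by positivity : 0 ≤ 1 / (8 * freq μ k ^ 3))]
  have h1 : |∫ η in τ₀..τ, ((1 - Real.cos (2 * freq μ k * (τ - η))) * F₁ η -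
      (1 - Real.cos (2 * freq μ k * (τ - η))) * F₂ η)| ≤ 2 * (δ * C / freq μ k) * ℓ := by
    refine abs_intervalIntegral_le_mul hτ hℓ (by positivity) fun t ht => ?_
    rw [← mul_sub, abs_mul]
    exact mul_le_mul (abs_one_sub_cos_le _) (h t ht) (abs_nonneg _) (by norm_num)
  calc _ ≤ 1 / (8 * freq μ k ^ 3) * (2 * (δ * C / freq μ k) * ℓ) := by gcongr
    _ = 1 / 4 * (δ * (C * ℓ) / freq μ k ^ 4) := by field_simp; ring
    _ ≤ 1 * (δ * (C * ℓ) / freq μ k ^ 4) := by gcongr; norm_num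
    _ = _ := one_mul _

/-- Reference point that turns the Lipschitz bound into an absolute bound. -/
lemma higherOrderDensity_zero {μ τ₀ τ : ℝ} (hμ : 0 < μ) (hτ : τ₀ ≤ τ) (k : ℝ) :
    higherOrderDensity μ τ₀ (fun _ => 0) τ k = 0 := by
  obtain ⟨F, hF, e, r⟩ := exists_response_higherOrderDensity (τ₀ := τ₀) (k := k) hμ
    (continuous_const : Continuous fun _ : ℝ => (0 : ℝ))
  have hF0 : ∀ t, τ₀ ≤ t → F t = 0 := fun t ht => by
    rw [e t ht]
    simp [responseKernel, primitive]
  rw [r τ hτ]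
  have : ∫ η in τ₀..τ, (1 - Real.cos (2 * freq μ k * (τ - η))) * F η = ∫ η in τ₀..τ, (0 : ℝ) := by
    refine intervalIntegral.integral_congr fun η hη => ?_
    rw [Set.uIcc_of_le hτ] at hη
    simp [hF0 η hη.1]
  rw [this]
  simp

lemma exists_higherOrderDensity_bound {μ τ₀ τ : ℝ} (hμ : 0 < μ) (hτ : τ₀ ≤ τ) {v : ℝ → ℝ}
    (hv : Continuous v) :
    ∃ C, 0 ≤ C ∧ ∀ k, |higherOrderDensity μ τ₀ v τ k| ≤ C / freq μ k ^ 4 := by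
  obtain ⟨M, hM⟩ := exists_abs_le_of_continuous hv τ₀ τ
  have hM0 : 0 ≤ M := (abs_nonneg _).trans (hM τ₀ ⟨le_rfl, hτ⟩)
  obtain ⟨C, hC0, hC⟩ := exists_higherOrderDensity_lipschitz hμ hM0 (sub_nonneg.2 hτ)
  refine ⟨M * C, by positivity, fun k => ?_⟩
  have := hC τ₀ τ hτ le_rfl v (fun _ => 0) hv continuous_const hM (by simpa using fun _ _ _ => hM0)
    M hM0 (by simpa using hM) k
  rwa [higherOrderDensity_zero hμ hτ, sub_zero] at this

lemma measurable_higherOrderDensity {μ τ₀ τ : ℝ} (hμ : 0 < μ) {v : ℝ → ℝ}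
    (hv : Continuous v) (hτ : τ₀ ≤ τ) : Measurable (higherOrderDensity μ τ₀ v τ) :=
  (measurable_modeDensity hμ hv hτ).sub (continuous_firstOrderDensity hμ τ₀ τ hv).measurable

/-! ### Momentum integrals and removal of the cut-off -/

lemma sq_mul_div_freq_pow_four_le {μ : ℝ} (hμ : 0 < μ) {C : ℝ} (hC : 0 ≤ C) (k : ℝ) :
    k ^ 2 * (C / freq μ k ^ 4) ≤ C * freq μ k ^ (-2 : ℝ) := by
  have hf := freq_pos hμ k
  have h2 : k ^ 2 ≤ freq μ k ^ 2 := by nlinarith [freq_sq μ k, sq_nonneg μ]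
  have h3 : freq μ k ^ (-2 : ℝ) = (freq μ k ^ 2)⁻¹ := by
    rw [Real.rpow_neg hf.le]; norm_num
  rw [h3]
  calc k ^ 2 * (C / freq μ k ^ 4) ≤ freq μ k ^ 2 * (C / freq μ k ^ 4) := by gcongr
    _ = _ := by field_simp

lemma integrableOn_freq_neg_two {μ : ℝ} (hμ : 0 < μ) :
    IntegrableOn (fun k => freq μ k ^ (-2 : ℝ)) (Set.Ioi 0) :=
  integrableOn_freq_rpow hμ (by norm_num)

lemma norm_higherOrder_integrand_le {μ τ₀ τ ε k C : ℝ} (hμ : 0 < μ) (hC : 0 ≤ C) {v : ℝ → ℝ}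
    (h : |higherOrderDensity μ τ₀ v τ k| ≤ C / freq μ k ^ 4) (hε : 0 ≤ ε) (hk : 0 < k) :
    ‖k ^ 2 * higherOrderDensity μ τ₀ v τ k * Real.exp (-ε * k)‖ ≤ C * freq μ k ^ (-2 : ℝ) := by
  have h1 : Real.exp (-ε * k) ≤ 1 := Real.exp_le_one_iff.2 (by nlinarith [mul_nonneg hε hk.le])
  rw [norm_mul, norm_mul, Real.norm_eq_abs, Real.norm_eq_abs, Real.norm_eq_abs, Real.abs_exp,
    abs_of_nonneg (sq_nonneg k)]
  calc _ ≤ k ^ 2 * (C / freq μ k ^ 4) * 1 := by gcongr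
    _ ≤ _ := by rw [mul_one]; exact sq_mul_div_freq_pow_four_le hμ hC k

lemma integrableOn_higherOrder {μ τ₀ τ ε : ℝ} (hμ : 0 < μ) (hτ : τ₀ ≤ τ) {v : ℝ → ℝ}
    (hv : Continuous v) (hε : 0 ≤ ε) :
    IntegrableOn (fun k => k ^ 2 * higherOrderDensity μ τ₀ v τ k * Real.exp (-ε * k))
      (Set.Ioi 0) := by
  obtain ⟨C, hC0, hC⟩ := exists_higherOrderDensity_bound hμ hτ hv
  have hm := measurable_higherOrderDensity hμ hv hτ
  refine Integrable.mono' ((integrableOn_freq_neg_two hμ).const_mul C)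
    (by fun_prop) ?_
  exact (ae_restrict_mem measurableSet_Ioi).mono fun k hk =>
    norm_higherOrder_integrand_le hμ hC0 (hC k) hε hk

/-- Dominated convergence. The factor `Real.exp (-0 * k)` is 1; it keeps the shape of the integrand
at ε = 0. -/
lemma tendsto_integral_higherOrder {μ τ₀ τ : ℝ} (hμ : 0 < μ) (hτ : τ₀ ≤ τ) {v : ℝ → ℝ}
    (hv : Continuous v) :
    Tendsto (fun ε => ∫ k in Set.Ioi (0 : ℝ),
      k ^ 2 * higherOrderDensity μ τ₀ v τ k * Real.exp (-ε * k)) (𝓝[>] 0)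
      (𝓝 (∫ k in Set.Ioi (0 : ℝ), k ^ 2 * higherOrderDensity μ τ₀ v τ k * Real.exp (-0 * k))) := by
  obtain ⟨C, hC0, hC⟩ := exists_higherOrderDensity_bound hμ hτ hv
  have hm := measurable_higherOrderDensity hμ hv hτ
  refine tendsto_integral_filter_of_dominated_convergence
    (fun k => C * freq μ k ^ (-2 : ℝ)) ?_ ?_ ((integrableOn_freq_neg_two hμ).const_mul C) ?_
  · exact .of_forall fun ε => by fun_prop
  · filter_upwards [self_mem_nhdsWithin] with ε hε
    exact (ae_restrict_mem measurableSet_Ioi).mono fun k hk =>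
      norm_higherOrder_integrand_le hμ hC0 (hC k) (le_of_lt hε) hk
  · refine .of_forall fun k => ?_
    have : Continuous fun ε => k ^ 2 * higherOrderDensity μ τ₀ v τ k * Real.exp (-ε * k) := by
      fun_prop
    exact (this.tendsto 0).mono_left nhdsWithin_le_nhds

lemma abs_integral_higherOrder_sub_le {μ τ₀ τ ε C : ℝ} (hμ : 0 < μ) (hτ : τ₀ ≤ τ)
    {v₁ v₂ : ℝ → ℝ} (hv₁ : Continuous v₁) (hv₂ : Continuous v₂) (hε : 0 ≤ ε) (hC : 0 ≤ C)
    (h : ∀ k, |higherOrderDensity μ τ₀ v₁ τ k - higherOrderDensity μ τ₀ v₂ τ k| ≤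
      C / freq μ k ^ 4) :
    |(∫ k in Set.Ioi (0 : ℝ), k ^ 2 * higherOrderDensity μ τ₀ v₁ τ k * Real.exp (-ε * k)) -
      ∫ k in Set.Ioi (0 : ℝ), k ^ 2 * higherOrderDensity μ τ₀ v₂ τ k * Real.exp (-ε * k)| ≤
      C * ∫ k in Set.Ioi (0 : ℝ), freq μ k ^ (-2 : ℝ) := by
  rw [← integral_sub (integrableOn_higherOrder hμ hτ hv₁ hε)
    (integrableOn_higherOrder hμ hτ hv₂ hε), ← integral_const_mul, ← Real.norm_eq_abs]
  refine norm_integral_le_of_norm_le ((integrableOn_freq_neg_two hμ).const_mul C)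
    ((ae_restrict_mem measurableSet_Ioi).mono fun k hk => ?_)
  have hk : 0 < k := hk
  have h1 : Real.exp (-ε * k) ≤ 1 := Real.exp_le_one_iff.2 (by nlinarith [mul_nonneg hε hk.le])
  rw [← sub_mul, ← mul_sub, norm_mul, norm_mul, Real.norm_eq_abs, Real.norm_eq_abs,
    Real.norm_eq_abs, Real.abs_exp, abs_of_nonneg (sq_nonneg k)]
  calc _ ≤ k ^ 2 * (C / freq μ k ^ 4) * 1 := by gcongr; exact h k
    _ ≤ _ := by rw [mul_one]; exact sq_mul_div_freq_pow_four_le hμ hC k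

lemma norm_firstOrder_integrand_le {μ τ₀ τ ε M k : ℝ} (hμ : 0 < μ) (hM : 0 ≤ M) (hτ : τ₀ ≤ τ)
    {v : ℝ → ℝ} (h : ∀ t ∈ Set.Icc τ₀ τ, |v t| ≤ M) :
    ‖k ^ 2 * firstOrderDensity μ τ₀ v τ k * Real.exp (-ε * k)‖ ≤
      M * (τ - τ₀) / μ * Real.exp (-ε * k) := by
  have hf := freq_pos hμ k
  have h1 := abs_firstOrderDensity_le (k := k) hμ hM hτ le_rfl h
  have h2 := sq_div_freq_cube_le hμ k
  have h3 : 0 ≤ τ - τ₀ := sub_nonneg.2 hτ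
  rw [norm_mul, norm_mul, Real.norm_eq_abs, Real.norm_eq_abs, Real.norm_eq_abs, Real.abs_exp,
    abs_of_nonneg (sq_nonneg k)]
  gcongr
  calc k ^ 2 * |firstOrderDensity μ τ₀ v τ k|
      ≤ k ^ 2 * (M * (τ - τ₀) / freq μ k ^ 3) := by gcongr
    _ = M * (τ - τ₀) * (k ^ 2 / freq μ k ^ 3) := by ring
    _ ≤ M * (τ - τ₀) * (1 / μ) := by gcongr
    _ = _ := by ring

lemma integrableOn_firstOrder {μ τ₀ τ ε : ℝ} (hμ : 0 < μ) (hτ : τ₀ ≤ τ) {v : ℝ → ℝ}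
    (hv : Continuous v) (hε : 0 < ε) :
    IntegrableOn (fun k => k ^ 2 * firstOrderDensity μ τ₀ v τ k * Real.exp (-ε * k))
      (Set.Ioi 0) := by
  obtain ⟨M, hM⟩ := exists_abs_le_of_continuous hv τ₀ τ
  have hM0 : 0 ≤ M := (abs_nonneg _).trans (hM τ₀ ⟨le_rfl, hτ⟩)
  have hc := continuous_firstOrderDensity hμ τ₀ τ hv
  refine Integrable.mono' ((integrableOn_exp_neg_mul hε).const_mul (M * (τ - τ₀) / μ))
    (Continuous.aestronglyMeasurable (by fun_prop)) ?_
  exact .of_forall fun k => norm_firstOrder_integrand_le hμ hM0 hτ hM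

/-- Fubini, legitimate because the cut-off makes the double integral absolutely convergent. The
k-integral is now done first, where the oscillations help. -/
lemma integral_firstOrder_eq {μ τ₀ τ ε : ℝ} (hμ : 0 < μ) (hτ : τ₀ ≤ τ) {v : ℝ → ℝ}
    (hv : Continuous v) (hε : 0 < ε) :
    ∫ k in Set.Ioi (0 : ℝ), k ^ 2 * firstOrderDensity μ τ₀ v τ k * Real.exp (-ε * k) =
      1 / 4 * ∫ η in τ₀..τ, oscKernel μ ε (τ - η) * v η := by
  obtain ⟨M, hM⟩ := exists_abs_le_of_continuous hv τ₀ τ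
  have hM0 : 0 ≤ M := (abs_nonneg _).trans (hM τ₀ ⟨le_rfl, hτ⟩)
  set g : ℝ → ℝ → ℝ := fun k η => k ^ 2 / freq μ k ^ 3 * Real.cos (2 * freq μ k * (τ - η)) *
    Real.exp (-ε * k) * v η with hg
  have hgc : Continuous (Function.uncurry g) :=
    ((continuous_oscKernel_integrand hμ ε).comp
      (by fun_prop : Continuous fun p : ℝ × ℝ => (p.1, τ - p.2))).mul (hv.comp continuous_snd)
  have hint : Integrable (Function.uncurry g)
      ((volume.restrict (Set.Ioi 0)).prod (volume.restrict (Set.Ioc τ₀ τ))) := by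
    have hdom : Integrable (fun p : ℝ × ℝ => (1 / μ * Real.exp (-ε * p.1)) * M)
        ((volume.restrict (Set.Ioi 0)).prod (volume.restrict (Set.Ioc τ₀ τ))) :=
      Integrable.mul_prod (f := fun k => 1 / μ * Real.exp (-ε * k)) (g := fun _ => M)
        ((integrableOn_exp_neg_mul hε).const_mul (1 / μ)) (integrable_const M)
    refine hdom.mono' hgc.aestronglyMeasurable ?_
    rw [Measure.prod_restrict]
    refine (ae_restrict_mem (measurableSet_Ioi.prod measurableSet_Ioc)).mono fun p hp => ?_
    simp only [Function.uncurry_def, hg, norm_mul _ (v p.2)]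
    exact mul_le_mul (abs_oscKernel_integrand_le hμ ε _ _) (hM p.2 ⟨hp.2.1.le, hp.2.2⟩)
      (norm_nonneg _) (by positivity)
  have hswap := integral_integral_swap hint
  rw [intervalIntegral.integral_of_le hτ, ← integral_const_mul]
  calc _ = ∫ k in Set.Ioi (0 : ℝ), 1 / 4 * ∫ η in Set.Ioc τ₀ τ, g k η := by
        congr 1
        funext k
        have hf := freq_pos hμ k
        rw [firstOrderDensity, intervalIntegral.integral_of_le hτ, ← integral_const_mul,
          ← integral_const_mul, ← integral_const_mul, ← integral_mul_const]
        congr 1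
        funext η
        simp only [hg]
        field_simp
    _ = _ := by
        rw [integral_const_mul, hswap, ← integral_const_mul]
        congr 1
        funext η
        simp only [hg, oscKernel, integral_mul_const]

lemma integral_sub_rpow_neg_half (τ₀ τ : ℝ) :
    ∫ η in τ₀..τ, (τ - η) ^ (-(1 / 2) : ℝ) = 2 * Real.sqrt (τ - τ₀) := by
  rw [intervalIntegral.integral_comp_sub_left (fun x => x ^ (-(1 / 2) : ℝ)),
    integral_rpow (Or.inl (by norm_num)), Real.sqrt_eq_rpow]
  norm_num
  ring

lemma intervalIntegrable_sub_rpow_neg_half (τ₀ τ : ℝ) :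
    IntervalIntegrable (fun η => (τ - η) ^ (-(1 / 2) : ℝ)) volume τ₀ τ := by
  have h : IntervalIntegrable (fun x : ℝ => x ^ (-(1 / 2) : ℝ)) volume (τ - τ₀) (τ - τ) :=
    intervalIntegral.intervalIntegrable_rpow' (by norm_num)
  simpa using h.comp_sub_left τ

/-- The kernel bounds need a positive time difference, so the endpoint η = τ has to be discarded. -/
lemma ae_lt_of_mem_Ioc (τ₀ τ : ℝ) : ∀ᵐ η : ℝ, η ∈ Set.Ioc τ₀ τ → η < τ := by
  have : ∀ᵐ η : ℝ, η ≠ τ := by simp [ae_iff]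
  exact this.mono fun η h1 h2 => lt_of_le_of_ne h2.2 h1

/-- The bound is uniform in ε and uses only the sup norm of v, because s^(-1/2) is integrable at 0.
-/
lemma abs_integral_oscKernel_le {μ τ₀ τ ε δ : ℝ} (hμ : 0 < μ) (hτ : τ₀ ≤ τ) (hε : 0 < ε)
    {v : ℝ → ℝ} (h : ∀ t ∈ Set.Icc τ₀ τ, |v t| ≤ δ) :
    |∫ η in τ₀..τ, oscKernel μ ε (τ - η) * v η| ≤ oscBound μ * δ * (2 * Real.sqrt (τ - τ₀)) := by
  rw [← integral_sub_rpow_neg_half τ₀ τ, ← intervalIntegral.integral_const_mul, ← Real.norm_eq_abs]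
  refine intervalIntegral.norm_integral_le_of_norm_le hτ ?_
    ((intervalIntegrable_sub_rpow_neg_half τ₀ τ).const_mul _)
  refine (ae_lt_of_mem_Ioc τ₀ τ).mono fun η hη hη' => ?_
  have hs : 0 < τ - η := sub_pos.2 (hη hη')
  rw [Real.norm_eq_abs, abs_mul]
  calc _ ≤ (oscBound μ * (τ - η) ^ (-(1 / 2) : ℝ)) * δ :=
        mul_le_mul (abs_oscKernel_le hμ hε hs) (h η ⟨hη'.1.le, hη'.2⟩) (abs_nonneg _)
          (mul_nonneg (oscBound_nonneg μ) (by positivity))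
    _ = _ := by ring

lemma tendsto_integral_oscKernel {μ τ₀ τ : ℝ} (hμ : 0 < μ) (hτ : τ₀ ≤ τ) {v : ℝ → ℝ}
    (hv : Continuous v) :
    Tendsto (fun ε => ∫ η in τ₀..τ, oscKernel μ ε (τ - η) * v η) (𝓝[>] 0)
      (𝓝 (∫ η in τ₀..τ, limitKernel μ (τ - η) * v η)) := by
  obtain ⟨M, hM⟩ := exists_abs_le_of_continuous hv τ₀ τ
  refine intervalIntegral.tendsto_integral_filter_of_dominated_convergence
    (fun η => oscBound μ * (τ - η) ^ (-(1 / 2) : ℝ) * M) ?_ ?_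
    (((intervalIntegrable_sub_rpow_neg_half τ₀ τ).const_mul _).mul_const _) ?_
  · filter_upwards [self_mem_nhdsWithin] with ε hε
    have := continuous_oscKernel hμ hε
    exact Continuous.aestronglyMeasurable (by fun_prop)
  · filter_upwards [self_mem_nhdsWithin] with ε hε
    refine (ae_lt_of_mem_Ioc τ₀ τ).mono fun η hη hη' => ?_
    rw [Set.uIoc_of_le hτ] at hη'
    have hs : 0 < τ - η := sub_pos.2 (hη hη')
    rw [norm_mul]
    exact mul_le_mul (abs_oscKernel_le hμ hε hs) (hM η ⟨hη'.1.le, hη'.2⟩) (norm_nonneg _)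
      (mul_nonneg (oscBound_nonneg μ) (by positivity))
  · refine (ae_lt_of_mem_Ioc τ₀ τ).mono fun η hη hη' => ?_
    rw [Set.uIoc_of_le hτ] at hη'
    exact (tendsto_oscKernel hμ (sub_pos.2 (hη hη'))).mul_const _

/-- The integral of the density over `ℝ³`, with cut-off. -/
def cutoffIntegral (μ τ₀ : ℝ) (v : ℝ → ℝ) (τ ε : ℝ) : ℝ :=
  ∫ k : EuclideanSpace ℝ (Fin 3), modeDensity μ τ₀ v τ ‖k‖ * Real.exp (-ε * ‖k‖)

/-- The area of the unit sphere of `ℝ³`. -/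
def sphereArea : ℝ :=
  3 * (volume : Measure (EuclideanSpace ℝ (Fin 3))).real (Metric.ball 0 1)

lemma sphereArea_nonneg : 0 ≤ sphereArea := by unfold sphereArea; positivity

lemma modeDensity_eq_add (μ τ₀ : ℝ) (v : ℝ → ℝ) (τ k ε : ℝ) :
    k ^ 2 * (modeDensity μ τ₀ v τ k * Real.exp (-ε * k)) =
      k ^ 2 * firstOrderDensity μ τ₀ v τ k * Real.exp (-ε * k) +
      k ^ 2 * higherOrderDensity μ τ₀ v τ k * Real.exp (-ε * k) := by
  simp only [higherOrderDensity]; ring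

lemma integrable_cutoff {μ τ₀ τ ε : ℝ} (hμ : 0 < μ) (hτ : τ₀ ≤ τ) {v : ℝ → ℝ}
    (hv : Continuous v) (hε : 0 < ε) :
    Integrable fun k : EuclideanSpace ℝ (Fin 3) =>
      modeDensity μ τ₀ v τ ‖k‖ * Real.exp (-ε * ‖k‖) := by
  refine (integrable_fun_norm_addHaar (volume : Measure (EuclideanSpace ℝ (Fin 3)))
    (f := fun k => modeDensity μ τ₀ v τ k * Real.exp (-ε * k))).2 ?_
  have : (fun y : ℝ => y ^ (Module.finrank ℝ (EuclideanSpace ℝ (Fin 3)) - 1) •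
      (modeDensity μ τ₀ v τ y * Real.exp (-ε * y))) = fun k =>
      k ^ 2 * firstOrderDensity μ τ₀ v τ k * Real.exp (-ε * k) +
      k ^ 2 * higherOrderDensity μ τ₀ v τ k * Real.exp (-ε * k) := by
    funext k
    rw [← modeDensity_eq_add, finrank_euclideanSpace_fin, smul_eq_mul]
  rw [this]
  exact (integrableOn_firstOrder hμ hτ hv hε).add (integrableOn_higherOrder hμ hτ hv hε.le)

/-- Polar coordinates in ℝ³ produce the weight k² and the area of the sphere. -/
lemma cutoffIntegral_eq {μ τ₀ τ ε : ℝ} (hμ : 0 < μ) (hτ : τ₀ ≤ τ) {v : ℝ → ℝ}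
    (hv : Continuous v) (hε : 0 < ε) :
    cutoffIntegral μ τ₀ v τ ε = sphereArea *
      (1 / 4 * (∫ η in τ₀..τ, oscKernel μ ε (τ - η) * v η) +
        ∫ k in Set.Ioi (0 : ℝ), k ^ 2 * higherOrderDensity μ τ₀ v τ k * Real.exp (-ε * k)) := by
  have h := integral_fun_norm_addHaar (volume : Measure (EuclideanSpace ℝ (Fin 3)))
    (fun k => modeDensity μ τ₀ v τ k * Real.exp (-ε * k))
  rw [cutoffIntegral, h, finrank_euclideanSpace_fin, nsmul_eq_mul, smul_eq_mul, ← mul_assoc,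
    sphereArea]
  congr 1
  rw [← integral_firstOrder_eq hμ hτ hv hε, ← integral_add (integrableOn_firstOrder hμ hτ hv hε)
    (integrableOn_higherOrder hμ hτ hv hε.le)]
  congr 1
  funext k
  rw [← modeDensity_eq_add, smul_eq_mul]

/-- The limit of `cutoffIntegral` as the cut-off is removed. -/
def limitIntegral (μ τ₀ : ℝ) (v : ℝ → ℝ) (τ : ℝ) : ℝ := sphereArea *
  (1 / 4 * (∫ η in τ₀..τ, limitKernel μ (τ - η) * v η) +
    ∫ k in Set.Ioi (0 : ℝ), k ^ 2 * higherOrderDensity μ τ₀ v τ k * Real.exp (-0 * k))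

lemma tendsto_cutoffIntegral {μ τ₀ τ : ℝ} (hμ : 0 < μ) (hτ : τ₀ ≤ τ) {v : ℝ → ℝ}
    (hv : Continuous v) :
    Tendsto (cutoffIntegral μ τ₀ v τ) (𝓝[>] 0) (𝓝 (limitIntegral μ τ₀ v τ)) := by
  refine Tendsto.congr' ?_ ((((tendsto_integral_oscKernel hμ hτ hv).const_mul (1 / 4)).add
    (tendsto_integral_higherOrder hμ hτ hv)).const_mul sphereArea)
  filter_upwards [self_mem_nhdsWithin] with ε hε
  exact (cutoffIntegral_eq hμ hτ hv hε).symm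

lemma exists_limitIntegral_lipschitz {μ ℓ M : ℝ} (hμ : 0 < μ) (hM : 0 ≤ M) (hℓ0 : 0 ≤ ℓ) :
    ∃ C, 0 ≤ C ∧ ∀ τ₀ τ, τ₀ ≤ τ → τ - τ₀ ≤ ℓ → ∀ v₁ v₂ : ℝ → ℝ,
      Continuous v₁ → Continuous v₂ →
      (∀ t ∈ Set.Icc τ₀ τ, |v₁ t| ≤ M) → (∀ t ∈ Set.Icc τ₀ τ, |v₂ t| ≤ M) →
      ∀ δ, 0 ≤ δ → (∀ t ∈ Set.Icc τ₀ τ, |v₁ t - v₂ t| ≤ δ) →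
      |limitIntegral μ τ₀ v₁ τ - limitIntegral μ τ₀ v₂ τ| ≤ C * δ := by
  obtain ⟨C, hC0, hC⟩ := exists_higherOrderDensity_lipschitz hμ hM hℓ0
  set J : ℝ := ∫ k in Set.Ioi (0 : ℝ), freq μ k ^ (-2 : ℝ) with hJ
  have hJ0 : 0 ≤ J := integral_nonneg fun k => Real.rpow_nonneg (freq_nonneg μ k) _
  have hO := oscBound_nonneg μ
  have hS := sphereArea_nonneg
  refine ⟨sphereArea * (1 / 4 * (oscBound μ * (2 * Real.sqrt ℓ)) + C * J), by positivity,
    fun τ₀ τ hτ hℓ v₁ v₂ hv₁ hv₂ hM₁ hM₂ δ hδ hd => ?_⟩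
  -- The estimate is proved for every ε > 0 with constants independent of ε and then passes to the
  -- limit.
  refine le_of_tendsto (((tendsto_cutoffIntegral hμ hτ hv₁).sub
    (tendsto_cutoffIntegral hμ hτ hv₂)).abs) ?_
  filter_upwards [self_mem_nhdsWithin] with ε hε
  have hε : 0 < ε := hε
  have hK := continuous_oscKernel hμ hε
  have h1 := abs_integral_oscKernel_le hμ hτ hε (v := fun t => v₁ t - v₂ t) hd
  have h2 := abs_integral_higherOrder_sub_le hμ hτ hv₁ hv₂ hε.le (by positivity : 0 ≤ δ * C)
    (hC τ₀ τ hτ hℓ v₁ v₂ hv₁ hv₂ hM₁ hM₂ δ hδ hd)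
  simp only [mul_sub] at h1
  rw [intervalIntegral.integral_sub (Continuous.intervalIntegrable (by fun_prop) _ _)
    (Continuous.intervalIntegrable (by fun_prop) _ _)] at h1
  rw [cutoffIntegral_eq hμ hτ hv₁ hε, cutoffIntegral_eq hμ hτ hv₂ hε, ← mul_sub, abs_mul,
    abs_of_nonneg hS, mul_assoc]
  refine mul_le_mul_of_nonneg_left ?_ hS
  set A₁ := ∫ η in τ₀..τ, oscKernel μ ε (τ - η) * v₁ η
  set A₂ := ∫ η in τ₀..τ, oscKernel μ ε (τ - η) * v₂ η
  set B₁ := ∫ k in Set.Ioi (0 : ℝ), k ^ 2 * higherOrderDensity μ τ₀ v₁ τ k * Real.exp (-ε * k)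
  set B₂ := ∫ k in Set.Ioi (0 : ℝ), k ^ 2 * higherOrderDensity μ τ₀ v₂ τ k * Real.exp (-ε * k)
  have e : 1 / 4 * A₁ + B₁ - (1 / 4 * A₂ + B₂) = 1 / 4 * (A₁ - A₂) + (B₁ - B₂) := by ring
  rw [e]
  refine (abs_add_le _ _).trans ?_
  rw [abs_mul, abs_of_pos (by norm_num : (0 : ℝ) < 1 / 4)]
  have h3 : oscBound μ * δ * (2 * Real.sqrt (τ - τ₀)) ≤ oscBound μ * δ * (2 * Real.sqrt ℓ) := by
    gcongr
  nlinarith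

lemma limitIntegral_zero {μ τ₀ τ : ℝ} (hμ : 0 < μ) (hτ : τ₀ ≤ τ) :
    limitIntegral μ τ₀ (fun _ => 0) τ = 0 := by
  simp [limitIntegral, higherOrderDensity_zero hμ hτ]

/-- Pointwise limit along ε = 1/(n+1) of functions of τ that are measurable as parameter integrals;
continuity in τ is not needed for the Friedmann integral. -/
lemma aestronglyMeasurable_limitIntegral {μ : ℝ} (hμ : 0 < μ) (τ₀ T : ℝ) {v : ℝ → ℝ}
    (hv : Continuous v) :
    AEStronglyMeasurable (limitIntegral μ τ₀ v) (volume.restrict (Set.Ioc τ₀ T)) := by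
  have hm := measurable_modeDensity_uncurry hμ τ₀ hv
  have hc : ∀ ε, StronglyMeasurable fun τ => cutoffIntegral μ τ₀ v (max τ τ₀) ε := by
    intro ε
    unfold cutoffIntegral
    refine StronglyMeasurable.integral_prod_right
      (f := fun (τ : ℝ) (k : EuclideanSpace ℝ (Fin 3)) =>
        modeDensity μ τ₀ v (max τ τ₀) ‖k‖ * Real.exp (-ε * ‖k‖)) ?_
    refine Measurable.stronglyMeasurable ?_
    have h1 : Measurable fun p : ℝ × EuclideanSpace ℝ (Fin 3) => (‖p.2‖, p.1) := by fun_prop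
    have h2 := hm.comp h1
    simp only [Function.uncurry_def]
    exact h2.mul (by fun_prop)
  refine aestronglyMeasurable_of_tendsto_ae atTop
    (f := fun (n : ℕ) τ => cutoffIntegral μ τ₀ v (max τ τ₀) (1 / ((n : ℝ) + 1)))
    (fun n => (hc _).aestronglyMeasurable) ?_
  refine (ae_restrict_mem measurableSet_Ioc).mono fun τ hτ => ?_
  rw [max_eq_left hτ.1.le]
  refine (tendsto_cutoffIntegral hμ hτ.1.le hv).comp ?_
  refine tendsto_nhdsWithin_iff.2 ⟨tendsto_one_div_add_atTop_nhds_zero_nat,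
    .of_forall fun n => Set.mem_Ioi.2 Nat.one_div_pos_of_nat⟩

/-! ### Transfer to the modes and integrals of the theorem -/

/-- The recursion at time t sees the potential only on [τ₀, t], so it may be replaced by any
function agreeing with it up to time s. -/
lemma partialMode_eq_dysonTerm {m τ₀ s : ℝ} {a V : ℝ → ℝ} (k : ℝ)
    (h : ∀ t ∈ Set.Icc τ₀ s, potential m τ₀ a t = V t) (n : ℕ) :
    ∀ t ∈ Set.Icc τ₀ s,
      partialMode m τ₀ a k n t = dysonTerm (initialFrequency m τ₀ a k) τ₀ V n t := by
  induction n with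
  | zero => exact fun t _ => (dysonTerm_zero _ _ _ _).symm
  | succ n ih =>
    intro t ht
    rw [dysonTerm_succ, partialMode]
    refine intervalIntegral.integral_congr fun η hη => ?_
    rw [Set.uIcc_of_le ht.1] at hη
    have hη' : η ∈ Set.Icc τ₀ s := ⟨hη.1, hη.2.trans ht.2⟩
    simp only [h η hη', ih η hη']

lemma mode_eq_dysonMode {m τ₀ s t : ℝ} {a V : ℝ → ℝ} (k : ℝ)
    (h : ∀ t ∈ Set.Icc τ₀ s, potential m τ₀ a t = V t) (ht : t ∈ Set.Icc τ₀ s) :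
    mode m τ₀ a k t = dysonMode (initialFrequency m τ₀ a k) τ₀ V t :=
  tsum_congr fun n => partialMode_eq_dysonTerm k h n t ht

lemma initialFrequency_eq_freq (m τ₀ : ℝ) (a : ℝ → ℝ) (k : ℝ) :
    initialFrequency m τ₀ a k = freq (a τ₀ * m) k := by
  rw [initialFrequency, freq, mul_pow]

lemma subtractedMode_eq_modeDensity {m τ₀ s t : ℝ} {a v : ℝ → ℝ} (k : ℝ)
    (h : ∀ t ∈ Set.Icc τ₀ s, potential m τ₀ a t = primitive τ₀ v t) (ht : t ∈ Set.Icc τ₀ s) :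
    subtractedMode m τ₀ a t k = modeDensity (a τ₀ * m) τ₀ v t k := by
  rw [subtractedMode, modeDensity, mode_eq_dysonMode k h ht, initialFrequency_eq_freq, h t ht]

lemma cutoffModeIntegral_eq {m τ₀ s t : ℝ} {a v : ℝ → ℝ}
    (h : ∀ t ∈ Set.Icc τ₀ s, potential m τ₀ a t = primitive τ₀ v t) (ht : t ∈ Set.Icc τ₀ s) :
    cutoffModeIntegral m τ₀ a t = cutoffIntegral (a τ₀ * m) τ₀ v t := by
  funext ε
  simp only [cutoffModeIntegral, cutoffIntegral, subtractedMode_eq_modeDensity _ h ht]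

lemma modeIntegral_eq {m τ₀ s t : ℝ} {a v : ℝ → ℝ} (hμ : 0 < a τ₀ * m) (hv : Continuous v)
    (h : ∀ t ∈ Set.Icc τ₀ s, potential m τ₀ a t = primitive τ₀ v t) (ht : t ∈ Set.Icc τ₀ s) :
    modeIntegral m τ₀ a t = limitIntegral (a τ₀ * m) τ₀ v t := by
  rw [modeIntegral, cutoffModeIntegral_eq h ht]
  exact (tendsto_cutoffIntegral hμ ht.1 hv).limUnder_eq

/-! The dependence on `H` is causal. -/

lemma scaleFactor_congr {a₀ τ₀ t : ℝ} {H K : ℝ → ℝ} (ht : τ₀ ≤ t)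
    (h : Set.EqOn H K (Set.Icc τ₀ t)) : scaleFactor a₀ τ₀ H t = scaleFactor a₀ τ₀ K t := by
  have : ∫ η in τ₀..t, H η = ∫ η in τ₀..t, K η :=
    intervalIntegral.integral_congr (by rwa [Set.uIcc_of_le ht])
  rw [scaleFactor, scaleFactor, this]

/-- No convergence or regularity is required: the series and the cut-off integrals agree as
expressions, default values included. This allows arbitrary competitors in the uniqueness part. -/
lemma friedmannIntegrand_congr (m lam G Lam a₀ : ℝ) {τ₀ t : ℝ} {H K : ℝ → ℝ} (ht : τ₀ ≤ t)
    (h : Set.EqOn H K (Set.Icc τ₀ t)) :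
    friedmannIntegrand m lam G Lam a₀ τ₀ H t = friedmannIntegrand m lam G Lam a₀ τ₀ K t := by
  have ha : ∀ s ∈ Set.Icc τ₀ t, scaleFactor a₀ τ₀ H s = scaleFactor a₀ τ₀ K s := fun s hs =>
    scaleFactor_congr hs.1 fun x hx => h ⟨hx.1, hx.2.trans hs.2⟩
  have ha₀ := ha τ₀ ⟨le_rfl, ht⟩
  have hat := ha t ⟨ht, le_rfl⟩
  have hV : ∀ s ∈ Set.Icc τ₀ t, potential m τ₀ (scaleFactor a₀ τ₀ H) s =
      potential m τ₀ (scaleFactor a₀ τ₀ K) s := fun s hs => by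
    rw [potential, potential, ha s hs, ha₀]
  have hf : ∀ k, initialFrequency m τ₀ (scaleFactor a₀ τ₀ H) k =
      initialFrequency m τ₀ (scaleFactor a₀ τ₀ K) k := fun k => by
    rw [initialFrequency, initialFrequency, ha₀]
  have hs : ∀ k, subtractedMode m τ₀ (scaleFactor a₀ τ₀ H) t k =
      subtractedMode m τ₀ (scaleFactor a₀ τ₀ K) t k := fun k => by
    rw [subtractedMode, subtractedMode, mode_eq_dysonMode k hV ⟨ht, le_rfl⟩,
      mode_eq_dysonMode k (fun _ _ => rfl) ⟨ht, le_rfl⟩, hf, hV t ⟨ht, le_rfl⟩]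
  have hI : modeIntegral m τ₀ (scaleFactor a₀ τ₀ H) t =
      modeIntegral m τ₀ (scaleFactor a₀ τ₀ K) t := by
    have : cutoffModeIntegral m τ₀ (scaleFactor a₀ τ₀ H) t =
        cutoffModeIntegral m τ₀ (scaleFactor a₀ τ₀ K) t := by
      funext ε
      simp only [cutoffModeIntegral, hs]
    rw [modeIntegral, modeIntegral, this]
  rw [friedmannIntegrand, friedmannIntegrand, wickSquare, wickSquare, hI, hat, ha₀,
    h ⟨ht, le_rfl⟩]

/-! ### The Friedmann integrand as a Lipschitz functional of H -/

/-- The quotient `a₀ / a(H)`. -/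
def inverseScale (a₀ τ₀ : ℝ) (H : ℝ → ℝ) (t : ℝ) : ℝ := 1 - a₀ * ∫ η in τ₀..t, H η

lemma hasDerivAt_inverseScale (a₀ τ₀ : ℝ) {H : ℝ → ℝ} (hH : Continuous H) (t : ℝ) :
    HasDerivAt (inverseScale a₀ τ₀ H) (-(a₀ * H t)) t :=
  ((hasDerivAt_primitive hH τ₀ t).const_mul a₀).const_sub 1

lemma continuous_inverseScale (a₀ τ₀ : ℝ) {H : ℝ → ℝ} (hH : Continuous H) :
    Continuous (inverseScale a₀ τ₀ H) :=
  continuous_iff_continuousAt.2 fun t => (hasDerivAt_inverseScale a₀ τ₀ hH t).continuousAt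

lemma inverseScale_self (a₀ τ₀ : ℝ) (H : ℝ → ℝ) : inverseScale a₀ τ₀ H τ₀ = 1 := by
  simp [inverseScale]

lemma scaleFactor_self (a₀ τ₀ : ℝ) (H : ℝ → ℝ) : scaleFactor a₀ τ₀ H τ₀ = a₀ := by
  simp [scaleFactor]

/-- The derivative of the potential, as a function of `a₀ / a` and `H`. -/
def sourceFun (m a₀ : ℝ) (p : ℝ × ℝ) : ℝ := 2 * m ^ 2 * (a₀ / p.1) ^ 3 * p.2

/-- The retraction of the line onto `[a, b]`. -/
def clamp (a b t : ℝ) : ℝ := max a (min t b)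

lemma continuous_clamp (a b : ℝ) : Continuous (clamp a b) := by unfold clamp; fun_prop

lemma clamp_mem {a b : ℝ} (hab : a ≤ b) (t : ℝ) : clamp a b t ∈ Set.Icc a b :=
  ⟨le_max_left _ _, max_le hab (min_le_right _ _)⟩

lemma clamp_of_mem {a b t : ℝ} (ht : t ∈ Set.Icc a b) : clamp a b t = t := by
  rw [clamp, min_eq_left ht.2, max_eq_right ht.1]

/-- The derivative of the potential on `[τ₀, s]`, extended by constants. -/
def source (m a₀ τ₀ s : ℝ) (H : ℝ → ℝ) (t : ℝ) : ℝ :=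
  sourceFun m a₀ (inverseScale a₀ τ₀ H (clamp τ₀ s t), H (clamp τ₀ s t))

lemma continuous_source {m a₀ τ₀ s : ℝ} {H : ℝ → ℝ} (hH : Continuous H) (hs : τ₀ ≤ s)
    (hu : ∀ t ∈ Set.Icc τ₀ s, 0 < inverseScale a₀ τ₀ H t) : Continuous (source m a₀ τ₀ s H) := by
  have h1 := continuous_clamp τ₀ s
  have h2 := continuous_inverseScale a₀ τ₀ hH
  have h3 : ∀ t, inverseScale a₀ τ₀ H (clamp τ₀ s t) ≠ 0 := fun t => (hu _ (clamp_mem hs t)).ne'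
  unfold source sourceFun
  fun_prop (disch := assumption)

/-- Since (a₀/a)' = -a₀H, one gets V' = 2m²a³H: the source involves H but not its derivative. -/
lemma potential_eq_primitive {m a₀ τ₀ s : ℝ} {H : ℝ → ℝ} (hH : Continuous H) (hs : τ₀ ≤ s)
    (hu : ∀ t ∈ Set.Icc τ₀ s, 0 < inverseScale a₀ τ₀ H t) :
    ∀ t ∈ Set.Icc τ₀ s, potential m τ₀ (scaleFactor a₀ τ₀ H) t =
      primitive τ₀ (source m a₀ τ₀ s H) t := by
  intro t ht
  have h := intervalIntegral.integral_eq_sub_of_hasDerivAt (a := τ₀) (b := t)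
    (f := fun x => m ^ 2 * (a₀ * (inverseScale a₀ τ₀ H x)⁻¹) ^ 2)
    (f' := source m a₀ τ₀ s H) (fun x hx => ?_)
    ((continuous_source hH hs hu).intervalIntegrable _ _)
  · rw [primitive, h, inverseScale_self, potential, scaleFactor_self, scaleFactor, inverseScale]
    ring
  · rw [Set.uIcc_of_le ht.1] at hx
    have hx' : x ∈ Set.Icc τ₀ s := ⟨hx.1, hx.2.trans ht.2⟩
    have hne := (hu x hx').ne'
    refine (((((hasDerivAt_inverseScale a₀ τ₀ hH x).inv hne).const_mul a₀).pow 2).const_mul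
      (m ^ 2)).congr_deriv ?_
    rw [source, sourceFun, clamp_of_mem hx']
    generalize hw : inverseScale a₀ τ₀ H x = w at hne
    norm_num [hw]
    field_simp

/-- The right hand side of the Friedmann equation as a function of `a₀ / a`, of `H`, and of the
mode integral. -/
def friedmannFun (m lam G Lam a₀ : ℝ) (p : ℝ × ℝ × ℝ) : ℝ :=
  a₀ * p.1⁻¹ / (criticalHubble G ^ 2 - p.2.1 ^ 2) *
    (p.2.1 ^ 4 - 2 * criticalHubble G ^ 2 * p.2.1 ^ 2 - 15 / 2 * m ^ 4 +
      240 * Real.pi ^ 2 * (m ^ 2 * (p.1 ^ 2 / ((2 * Real.pi) ^ 3 * a₀ ^ 2) * p.2.2 +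
        m ^ 2 / (4 * Real.pi) ^ 2 * (1 / 2 - p.1 ^ 2 + 2 * Real.log p.1 +
          2 * Real.log (Real.exp Real.eulerMascheroniConstant * m * lam / Real.sqrt 2))) +
        4 * Lam))

lemma measurable_friedmannFun (m lam G Lam a₀ : ℝ) : Measurable (friedmannFun m lam G Lam a₀) := by
  unfold friedmannFun; fun_prop

lemma friedmannIntegrand_eq {m lam G Lam a₀ τ₀ t I : ℝ} {H : ℝ → ℝ} (ha₀ : 0 < a₀)
    (hu : 0 < inverseScale a₀ τ₀ H t) (hI : modeIntegral m τ₀ (scaleFactor a₀ τ₀ H) t = I) :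
    friedmannIntegrand m lam G Lam a₀ τ₀ H t =
      friedmannFun m lam G Lam a₀ (inverseScale a₀ τ₀ H t, H t, I) := by
  have ha : scaleFactor a₀ τ₀ H t = a₀ * (inverseScale a₀ τ₀ H t)⁻¹ := rfl
  have hq : scaleFactor a₀ τ₀ H τ₀ / scaleFactor a₀ τ₀ H t = inverseScale a₀ τ₀ H t := by
    rw [scaleFactor_self, ha]; field_simp
  have h2 : 1 / ((2 * Real.pi) ^ 3 * scaleFactor a₀ τ₀ H t ^ 2) =
      inverseScale a₀ τ₀ H t ^ 2 / ((2 * Real.pi) ^ 3 * a₀ ^ 2) := by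
    rw [ha]; field_simp
  rw [friedmannIntegrand, wickSquare, hq, hI, h2, ha, friedmannFun]

/-- `H` stays in a set where `a(H)` and `1 / (H_c² - H²)` are under control. -/
structure IsControlled (a₀ τ₀ h d s : ℝ) (H : ℝ → ℝ) : Prop where
  abs_le : ∀ t ∈ Set.Icc τ₀ s, |H t| ≤ h
  le_inverseScale : ∀ t ∈ Set.Icc τ₀ s, d ≤ inverseScale a₀ τ₀ H t

lemma IsControlled.mono {a₀ τ₀ h d s s' : ℝ} {H : ℝ → ℝ} (hc : IsControlled a₀ τ₀ h d s H)
    (hs : s' ≤ s) : IsControlled a₀ τ₀ h d s' H :=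
  ⟨fun t ht => hc.1 t ⟨ht.1, ht.2.trans hs⟩, fun t ht => hc.2 t ⟨ht.1, ht.2.trans hs⟩⟩

lemma IsControlled.pos {a₀ τ₀ h d s : ℝ} {H : ℝ → ℝ} (hc : IsControlled a₀ τ₀ h d s H)
    (hd : 0 < d) : ∀ t ∈ Set.Icc τ₀ s, 0 < inverseScale a₀ τ₀ H t :=
  fun t ht => hd.trans_le (hc.2 t ht)

/-- With the lower bound d this confines (a₀/a, H) to a compact convex box, on which C¹ functions
are Lipschitz. -/
lemma IsControlled.inverseScale_le {a₀ τ₀ h d s ℓ : ℝ} {H : ℝ → ℝ}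
    (hc : IsControlled a₀ τ₀ h d s H) (ha₀ : 0 < a₀) (hh : 0 ≤ h) (hℓ : s - τ₀ ≤ ℓ) :
    ∀ t ∈ Set.Icc τ₀ s, inverseScale a₀ τ₀ H t ≤ 1 + a₀ * (h * ℓ) := by
  intro t ht
  have h1 := abs_primitive_le (v := H) ht.1 (by linarith [ht.2] : t - τ₀ ≤ ℓ) hh
    fun x hx => hc.1 x ⟨hx.1, hx.2.trans ht.2⟩
  have h2 := neg_le_of_abs_le h1
  unfold inverseScale
  unfold primitive at h2
  nlinarith

lemma abs_inverseScale_sub_le {a₀ τ₀ t ℓ δ : ℝ} {H K : ℝ → ℝ} (ha₀ : 0 < a₀) (hH : Continuous H)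
    (hK : Continuous K) (ht : τ₀ ≤ t) (hℓ : t - τ₀ ≤ ℓ) (hδ : 0 ≤ δ)
    (h : ∀ x ∈ Set.Icc τ₀ t, |H x - K x| ≤ δ) :
    |inverseScale a₀ τ₀ H t - inverseScale a₀ τ₀ K t| ≤ a₀ * ℓ * δ := by
  have h1 := abs_primitive_le ht hℓ hδ h
  rw [primitive_sub hH hK] at h1
  have e : inverseScale a₀ τ₀ H t - inverseScale a₀ τ₀ K t =
      -(a₀ * (primitive τ₀ H t - primitive τ₀ K t)) := by
    unfold inverseScale primitive; ring
  rw [e, abs_neg, abs_mul, abs_of_pos ha₀]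
  nlinarith

lemma modeIntegral_scaleFactor_eq {m a₀ τ₀ s t : ℝ} (hm : 0 < m) (ha₀ : 0 < a₀) {H : ℝ → ℝ}
    (hH : Continuous H) (hu : ∀ t ∈ Set.Icc τ₀ s, 0 < inverseScale a₀ τ₀ H t)
    (ht : t ∈ Set.Icc τ₀ s) :
    modeIntegral m τ₀ (scaleFactor a₀ τ₀ H) t =
      limitIntegral (a₀ * m) τ₀ (source m a₀ τ₀ s H) t := by
  have hs := ht.1.trans ht.2
  have hμ : 0 < scaleFactor a₀ τ₀ H τ₀ * m := by rw [scaleFactor_self]; positivity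
  rw [modeIntegral_eq hμ (continuous_source hH hs hu) (potential_eq_primitive hH hs hu) ht,
    scaleFactor_self]

lemma exists_sourceFun_lipschitz (m a₀ : ℝ) {d U h : ℝ} (hd : 0 < d) :
    ∃ L : NNReal, LipschitzOnWith L (sourceFun m a₀) (Set.Icc d U ×ˢ Set.Icc (-h) h) := by
  refine ContDiffOn.exists_lipschitzOnWith (n := 1) ?_ one_ne_zero
    ((convex_Icc d U).prod (convex_Icc (-h) h)) (isCompact_Icc.prod isCompact_Icc)
  have h1 : ∀ p ∈ Set.Icc d U ×ˢ Set.Icc (-h) h, p.1 ≠ 0 := fun p hp =>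
    (hd.trans_le hp.1.1).ne'
  unfold sourceFun
  fun_prop (disch := assumption)

lemma contDiffOn_friedmannFun (m lam G Lam a₀ : ℝ) {d U h B : ℝ} (hd : 0 < d)
    (hh : h < criticalHubble G) :
    ContDiffOn ℝ 1 (friedmannFun m lam G Lam a₀)
      (Set.Icc d U ×ˢ Set.Icc (-h) h ×ˢ Set.Icc (-B) B) := by
  have h1 : ∀ p ∈ Set.Icc d U ×ˢ Set.Icc (-h) h ×ˢ Set.Icc (-B) B, p.1 ≠ 0 := fun p hp =>
    (hd.trans_le hp.1.1).ne'
  have h2 : ∀ p ∈ Set.Icc d U ×ˢ Set.Icc (-h) h ×ˢ Set.Icc (-B) B,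
      criticalHubble G ^ 2 - p.2.1 ^ 2 ≠ 0 := fun p hp => by
    have h3 := hp.2.1
    have : 0 < (criticalHubble G - p.2.1) * (criticalHubble G + p.2.1) :=
      mul_pos (by linarith [h3.2]) (by linarith [h3.1])
    nlinarith
  unfold friedmannFun
  fun_prop (disch := assumption)

lemma IsControlled.mem_box {a₀ τ₀ h d s ℓ t : ℝ} {H : ℝ → ℝ} (hc : IsControlled a₀ τ₀ h d s H)
    (ha₀ : 0 < a₀) (hh : 0 ≤ h) (hℓ : s - τ₀ ≤ ℓ) (ht : t ∈ Set.Icc τ₀ s) :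
    (inverseScale a₀ τ₀ H t, H t) ∈ Set.Icc d (1 + a₀ * (h * ℓ)) ×ˢ Set.Icc (-h) h :=
  ⟨⟨hc.2 t ht, hc.inverseScale_le ha₀ hh hℓ t ht⟩, _root_.abs_le.1 (hc.1 t ht)⟩

lemma abs_sub_le_of_lipschitzOnWith {X : Type*} [PseudoMetricSpace X] {L : NNReal} {f : X → ℝ}
    {S : Set X} (hf : LipschitzOnWith L f S) {x y : X} (hx : x ∈ S) (hy : y ∈ S) {δ : ℝ}
    (h : dist x y ≤ δ) : |f x - f y| ≤ L * δ := by
  rw [← Real.dist_eq]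
  exact (hf.dist_le_mul x hx y hy).trans (mul_le_mul_of_nonneg_left h L.2)

/-- On the controlled functions, the mode integral is bounded and Lipschitz. -/
lemma exists_modeIntegral_bounds {m a₀ h d ℓ : ℝ} (hm : 0 < m) (ha₀ : 0 < a₀) (hh : 0 ≤ h)
    (hd : 0 < d) (hℓ0 : 0 ≤ ℓ) :
    ∃ C B, 0 ≤ C ∧ 0 ≤ B ∧ ∀ τ₀ s, τ₀ ≤ s → s - τ₀ ≤ ℓ → ∀ H, Continuous H →
      IsControlled a₀ τ₀ h d s H →
      |modeIntegral m τ₀ (scaleFactor a₀ τ₀ H) s| ≤ B ∧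
      ∀ K, Continuous K → IsControlled a₀ τ₀ h d s K → ∀ δ, 0 ≤ δ →
        (∀ t ∈ Set.Icc τ₀ s, |H t - K t| ≤ δ) →
        |modeIntegral m τ₀ (scaleFactor a₀ τ₀ H) s -
          modeIntegral m τ₀ (scaleFactor a₀ τ₀ K) s| ≤ C * δ := by
  obtain ⟨L, hL⟩ := exists_sourceFun_lipschitz m a₀ (U := 1 + a₀ * (h * ℓ)) (h := h) hd
  obtain ⟨M', hM'⟩ := (isCompact_Icc.prod isCompact_Icc).exists_bound_of_continuousOn hL.continuousOn
  set M := max M' 0 with hM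
  have hM0 : 0 ≤ M := le_max_right _ _
  obtain ⟨C, hC0, hC⟩ := exists_limitIntegral_lipschitz (μ := a₀ * m) (by positivity) hM0 hℓ0
  have hL0 : (0 : ℝ) ≤ L := L.2
  -- If |H - K| ≤ δ, the pairs (a₀/a, H) are at distance at most (a₀ℓ + 1)δ, the maximum being
  -- bounded by the sum. The bound C * M is the comparison with the zero source.
  refine ⟨C * (L * (a₀ * ℓ + 1)), C * M, by positivity, by positivity,
    fun τ₀ s hs hℓ H hH hc => ?_⟩
  have hsrc : ∀ {F : ℝ → ℝ}, IsControlled a₀ τ₀ h d s F → ∀ t ∈ Set.Icc τ₀ s,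
      |source m a₀ τ₀ s F t| ≤ M := fun hF t _ =>
    (hM' _ (hF.mem_box ha₀ hh hℓ (clamp_mem hs t))).trans (le_max_left _ _)
  have hss : s ∈ Set.Icc τ₀ s := ⟨hs, le_rfl⟩
  have hHc := continuous_source (m := m) hH hs (hc.pos hd)
  rw [modeIntegral_scaleFactor_eq hm ha₀ hH (hc.pos hd) hss]
  refine ⟨?_, fun K hK hcK δ hδ hHK => ?_⟩
  · have := hC τ₀ s hs hℓ _ (fun _ => 0) hHc continuous_const (hsrc hc)
      (by simpa using fun _ _ _ => hM0) M hM0 (by simpa using hsrc hc)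
    rwa [limitIntegral_zero (by positivity) hs, sub_zero] at this
  · rw [modeIntegral_scaleFactor_eq hm ha₀ hK (hcK.pos hd) hss]
    have hKc := continuous_source (m := m) hK hs (hcK.pos hd)
    have h1 : ∀ t ∈ Set.Icc τ₀ s,
        |source m a₀ τ₀ s H t - source m a₀ τ₀ s K t| ≤ L * ((a₀ * ℓ + 1) * δ) := by
      intro t _
      have ht := clamp_mem hs t
      refine abs_sub_le_of_lipschitzOnWith hL (hc.mem_box ha₀ hh hℓ ht)
        (hcK.mem_box ha₀ hh hℓ ht) ?_
      have h2 := abs_inverseScale_sub_le ha₀ hH hK ht.1 (by linarith [ht.2] : _ ≤ ℓ) hδ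
        fun x hx => hHK x ⟨hx.1, hx.2.trans ht.2⟩
      have h3 := hHK _ ht
      have h4 : 0 ≤ a₀ * ℓ * δ := by positivity
      rw [Prod.dist_eq, Real.dist_eq, Real.dist_eq]
      exact max_le (by linarith) (by linarith)
    refine (hC τ₀ s hs hℓ _ _ hHc hKc (hsrc hc) (hsrc hcK) _ (by positivity) h1).trans_eq ?_
    ring

/-- On the controlled functions, the integrand of the Friedmann equation is bounded and
Lipschitz. -/
lemma exists_friedmannIntegrand_bounds {m G a₀ h d ℓ : ℝ} (lam Lam : ℝ) (hm : 0 < m)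
    (ha₀ : 0 < a₀) (hh : 0 ≤ h) (hhG : h < criticalHubble G) (hd : 0 < d) (hℓ0 : 0 ≤ ℓ) :
    ∃ L B, 0 ≤ L ∧ 0 ≤ B ∧ ∀ τ₀ s, τ₀ ≤ s → s - τ₀ ≤ ℓ → ∀ H, Continuous H →
      IsControlled a₀ τ₀ h d s H →
      |friedmannIntegrand m lam G Lam a₀ τ₀ H s| ≤ B ∧
      ∀ K, Continuous K → IsControlled a₀ τ₀ h d s K → ∀ δ, 0 ≤ δ →
        (∀ t ∈ Set.Icc τ₀ s, |H t - K t| ≤ δ) →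
        |friedmannIntegrand m lam G Lam a₀ τ₀ H s -
          friedmannIntegrand m lam G Lam a₀ τ₀ K s| ≤ L * δ := by
  obtain ⟨C, BI, hC0, hBI0, hI⟩ := exists_modeIntegral_bounds hm ha₀ hh hd hℓ0
  set S : Set (ℝ × ℝ × ℝ) := Set.Icc d (1 + a₀ * (h * ℓ)) ×ˢ Set.Icc (-h) h ×ˢ Set.Icc (-BI) BI
    with hS
  have hcd : ContDiffOn ℝ 1 (friedmannFun m lam G Lam a₀) S :=
    contDiffOn_friedmannFun m lam G Lam a₀ hd hhG
  have hSc : IsCompact S := isCompact_Icc.prod (isCompact_Icc.prod isCompact_Icc)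
  obtain ⟨L, hL⟩ := hcd.exists_lipschitzOnWith one_ne_zero
    ((convex_Icc _ _).prod ((convex_Icc _ _).prod (convex_Icc _ _))) hSc
  obtain ⟨B, hB⟩ := hSc.exists_bound_of_continuousOn hcd.continuousOn
  have hL0 : (0 : ℝ) ≤ L := L.2
  refine ⟨L * (a₀ * ℓ + 1 + C), max B 0, by positivity, le_max_right _ _,
    fun τ₀ s hs hℓ H hH hc => ?_⟩
  have hss : s ∈ Set.Icc τ₀ s := ⟨hs, le_rfl⟩
  have hmem : ∀ {F : ℝ → ℝ}, Continuous F → IsControlled a₀ τ₀ h d s F →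
      (inverseScale a₀ τ₀ F s, F s, modeIntegral m τ₀ (scaleFactor a₀ τ₀ F) s) ∈ S :=
    fun hF hFc => ⟨(hFc.mem_box ha₀ hh hℓ hss).1, (hFc.mem_box ha₀ hh hℓ hss).2,
      abs_le.1 (hI τ₀ s hs hℓ _ hF hFc).1⟩
  rw [friedmannIntegrand_eq ha₀ (hc.pos hd s hss) rfl]
  refine ⟨(hB _ (hmem hH hc)).trans (le_max_left _ _), fun K hK hcK δ hδ hHK => ?_⟩
  rw [friedmannIntegrand_eq ha₀ (hcK.pos hd s hss) rfl, mul_assoc]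
  refine abs_sub_le_of_lipschitzOnWith hL (hmem hH hc) (hmem hK hcK) ?_
  have h1 := abs_inverseScale_sub_le ha₀ hH hK hs hℓ hδ hHK
  have h2 := hHK s hss
  have h3 := (hI τ₀ s hs hℓ H hH hc).2 K hK hcK δ hδ hHK
  have h4 : 0 ≤ a₀ * ℓ * δ := by positivity
  have h5 : 0 ≤ C * δ := by positivity
  rw [Prod.dist_eq, Prod.dist_eq, Real.dist_eq, Real.dist_eq, Real.dist_eq]
  exact max_le (by linarith) (max_le (by linarith) (by linarith))

lemma intervalIntegrable_friedmannIntegrand {m G a₀ τ₀ h d s : ℝ} (lam Lam : ℝ) (hm : 0 < m)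
    (ha₀ : 0 < a₀) (hh : 0 ≤ h) (hhG : h < criticalHubble G) (hd : 0 < d) (hs : τ₀ ≤ s)
    {H : ℝ → ℝ} (hH : Continuous H) (hc : IsControlled a₀ τ₀ h d s H) :
    IntervalIntegrable (friedmannIntegrand m lam G Lam a₀ τ₀ H) volume τ₀ s := by
  obtain ⟨L, B, -, -, hLB⟩ := exists_friedmannIntegrand_bounds (ℓ := s - τ₀) lam Lam hm ha₀ hh hhG
    hd (sub_nonneg.2 hs)
  rw [intervalIntegrable_iff_integrableOn_Ioc_of_le hs]
  have hb : ∀ᵐ t ∂volume.restrict (Set.Ioc τ₀ s),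
      ‖friedmannIntegrand m lam G Lam a₀ τ₀ H t‖ ≤ B :=
    (ae_restrict_mem measurableSet_Ioc).mono fun t ht =>
      (hLB τ₀ t ht.1.le (by linarith [ht.2]) H hH (hc.mono ht.2)).1
  refine Integrable.mono' (integrable_const B) ?_ hb
  have hu := hc.pos hd
  -- A single source, frozen after time s, represents the mode integral at all times t ≤ s.
  have h1 := aestronglyMeasurable_limitIntegral (μ := a₀ * m) (by positivity) τ₀ s
    (continuous_source (m := m) hH hs hu)
  have h2 : AEMeasurable (fun t => friedmannFun m lam G Lam a₀ (inverseScale a₀ τ₀ H t, H t,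
      limitIntegral (a₀ * m) τ₀ (source m a₀ τ₀ s H) t)) (volume.restrict (Set.Ioc τ₀ s)) :=
    (measurable_friedmannFun m lam G Lam a₀).comp_aemeasurable
      ((continuous_inverseScale a₀ τ₀ hH).measurable.aemeasurable.prodMk
        (hH.measurable.aemeasurable.prodMk h1.aemeasurable))
  refine (h2.congr ((ae_restrict_mem measurableSet_Ioc).mono fun t ht => ?_)).aestronglyMeasurable
  have ht' : t ∈ Set.Icc τ₀ s := ⟨ht.1.le, ht.2⟩
  exact (friedmannIntegrand_eq ha₀ (hu t ht')
    (modeIntegral_scaleFactor_eq hm ha₀ hH hu ht')).symm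

lemma converges_of_isControlled {m G a₀ τ₀ h d s : ℝ} (lam Lam : ℝ) (hm : 0 < m)
    (ha₀ : 0 < a₀) (hh : 0 ≤ h) (hhG : h < criticalHubble G) (hd : 0 < d) (hs : τ₀ ≤ s)
    {H : ℝ → ℝ} (hH : Continuous H) (hc : IsControlled a₀ τ₀ h d s H) :
    Converges m lam G Lam a₀ τ₀ s H := by
  have hu := hc.pos hd
  have hv := continuous_source (m := m) hH hs hu
  have hV := potential_eq_primitive (m := m) hH hs hu
  have hμ : 0 < scaleFactor a₀ τ₀ H τ₀ * m := by rw [scaleFactor_self]; positivity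
  refine ⟨fun t ht k => ?_, fun t ht ε hε => ?_, fun t ht => ?_,
    intervalIntegrable_friedmannIntegrand lam Lam hm ha₀ hh hhG hd hs hH hc⟩
  · simp only [partialMode_eq_dysonTerm k hV _ t ht, initialFrequency_eq_freq]
    exact summable_dysonTerm (freq_pos hμ k) (continuous_primitive hv τ₀) ht.1
  · simp only [subtractedMode_eq_modeDensity _ hV ht]
    exact integrable_cutoff hμ ht.1 hv hε
  · rw [modeIntegral_eq hμ hv hV ht, cutoffModeIntegral_eq hV ht]
    exact tendsto_cutoffIntegral hμ ht.1 hv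

/-! ### Continuation of solutions of causal integral equations -/

/-- Continuous functions that agree with `b` on `[τ₀, τ₁]` and stay `r`-close to it on `[τ₀, s]`. -/
structure IsNear (b : ℝ → ℝ) (τ₀ τ₁ r s : ℝ) (K : ℝ → ℝ) : Prop where
  continuous : Continuous K
  eqOn : Set.EqOn K b (Set.Icc τ₀ τ₁)
  abs_sub_le : ∀ t ∈ Set.Icc τ₀ s, |K t - b t| ≤ r

lemma IsNear.mono {b : ℝ → ℝ} {τ₀ τ₁ r s s' : ℝ} {K : ℝ → ℝ} (h : IsNear b τ₀ τ₁ r s K)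
    (hs : s' ≤ s) : IsNear b τ₀ τ₁ r s' K :=
  ⟨h.1, h.2, fun t ht => h.3 t ⟨ht.1, ht.2.trans hs⟩⟩

section Continuation

variable {f : (ℝ → ℝ) → ℝ → ℝ} {b : ℝ → ℝ} {τ₀ τ₁ τ₂ r L B H₀ : ℝ}

lemma integral_congr_of_causal
    (hf : ∀ H K t, τ₀ ≤ t → Set.EqOn H K (Set.Icc τ₀ t) → f H t = f K t) {H K : ℝ → ℝ} {t : ℝ}
    (ht : τ₀ ≤ t) (h : Set.EqOn H K (Set.Icc τ₀ t)) :
    ∫ η in τ₀..t, f H η = ∫ η in τ₀..t, f K η := by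
  refine intervalIntegral.integral_congr fun η hη => ?_
  rw [Set.uIcc_of_le ht] at hη
  exact hf H K η hη.1 fun x hx => h ⟨hx.1, hx.2.trans hη.2⟩

/-- Up to τ₁ both integrands coincide by causality, so only an interval of length at most τ₂ - τ₁
counts; this small factor gives the contraction. -/
lemma abs_integral_sub_le_of_isNear (h01 : τ₀ ≤ τ₁)
    (hf : ∀ H K t, τ₀ ≤ t → Set.EqOn H K (Set.Icc τ₀ t) → f H t = f K t)
    (hI : ∀ s ∈ Set.Icc τ₁ τ₂, ∀ K, IsNear b τ₀ τ₁ r s K → IntervalIntegrable (f K) volume τ₀ s)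
    (hL0 : 0 ≤ L)
    (hL : ∀ s ∈ Set.Icc τ₁ τ₂, ∀ H K, IsNear b τ₀ τ₁ r s H → IsNear b τ₀ τ₁ r s K → ∀ δ, 0 ≤ δ →
      (∀ t ∈ Set.Icc τ₀ s, |H t - K t| ≤ δ) → |f H s - f K s| ≤ L * δ)
    {s : ℝ} (hs : s ∈ Set.Icc τ₁ τ₂) {H K : ℝ → ℝ} (hH : IsNear b τ₀ τ₁ r s H)
    (hK : IsNear b τ₀ τ₁ r s K) {δ : ℝ} (hδ : 0 ≤ δ)
    (hHK : ∀ t ∈ Set.Icc τ₀ s, |H t - K t| ≤ δ) {t : ℝ} (ht : t ∈ Set.Icc τ₀ s) :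
    |(∫ η in τ₀..t, f H η) - ∫ η in τ₀..t, f K η| ≤ L * δ * (τ₂ - τ₁) := by
  have h12 : τ₁ ≤ τ₂ := hs.1.trans hs.2
  rcases le_total t τ₁ with htτ | htτ
  · rw [integral_congr_of_causal hf ht.1 (fun x hx => ?_), sub_self, abs_zero]
    · have := sub_nonneg.2 h12
      positivity
    · have hx' : x ∈ Set.Icc τ₀ τ₁ := ⟨hx.1, hx.2.trans htτ⟩
      rw [hH.eqOn hx', hK.eqOn hx']
  · have ht' : t ∈ Set.Icc τ₁ τ₂ := ⟨htτ, ht.2.trans hs.2⟩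
    have hHt := hH.mono ht.2
    have hKt := hK.mono ht.2
    have hsub : Set.uIcc τ₀ τ₁ ⊆ Set.uIcc τ₀ t := by
      rw [Set.uIcc_of_le h01, Set.uIcc_of_le ht.1]
      exact Set.Icc_subset_Icc_right htτ
    have hsub' : Set.uIcc τ₁ t ⊆ Set.uIcc τ₀ t := by
      rw [Set.uIcc_of_le htτ, Set.uIcc_of_le ht.1]
      exact Set.Icc_subset_Icc_left h01
    have iH := hI t ht' H hHt
    have iK := hI t ht' K hKt
    rw [← intervalIntegral.integral_add_adjacent_intervals (iH.mono_set hsub) (iH.mono_set hsub'),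
      ← intervalIntegral.integral_add_adjacent_intervals (iK.mono_set hsub) (iK.mono_set hsub'),
      integral_congr_of_causal hf h01 (hH.eqOn.trans hK.eqOn.symm), add_sub_add_left_eq_sub,
      ← intervalIntegral.integral_sub (iH.mono_set hsub') (iK.mono_set hsub')]
    refine abs_intervalIntegral_le_mul htτ (by linarith [ht'.2]) (by positivity) fun η hη => ?_
    have hη' : η ≤ s := hη.2.trans ht.2
    exact hL η ⟨hη.1, hη.2.trans ht'.2⟩ H K (hH.mono hη') (hK.mono hη') δ hδ
      fun x hx => hHK x ⟨hx.1, hx.2.trans hη'⟩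

/-- Two nearby solutions of a causal integral equation coincide. -/
lemma eqOn_of_isNear (h01 : τ₀ ≤ τ₁)
    (hf : ∀ H K t, τ₀ ≤ t → Set.EqOn H K (Set.Icc τ₀ t) → f H t = f K t)
    (hI : ∀ s ∈ Set.Icc τ₁ τ₂, ∀ K, IsNear b τ₀ τ₁ r s K → IntervalIntegrable (f K) volume τ₀ s)
    (hL0 : 0 ≤ L)
    (hL : ∀ s ∈ Set.Icc τ₁ τ₂, ∀ H K, IsNear b τ₀ τ₁ r s H → IsNear b τ₀ τ₁ r s K → ∀ δ, 0 ≤ δ →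
      (∀ t ∈ Set.Icc τ₀ s, |H t - K t| ≤ δ) → |f H s - f K s| ≤ L * δ)
    (hsmall : L * (τ₂ - τ₁) ≤ 1 / 2)
    {s : ℝ} (hs : s ∈ Set.Icc τ₁ τ₂) {H K : ℝ → ℝ} (hH : IsNear b τ₀ τ₁ r s H)
    (hK : IsNear b τ₀ τ₁ r s K)
    (eH : ∀ t ∈ Set.Icc τ₀ s, H t = H₀ + ∫ η in τ₀..t, f H η)
    (eK : ∀ t ∈ Set.Icc τ₀ s, K t = H₀ + ∫ η in τ₀..t, f K η) :
    Set.EqOn H K (Set.Icc τ₀ s) := by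
  have hne : (Set.Icc τ₀ s).Nonempty := ⟨τ₀, le_rfl, h01.trans hs.1⟩
  -- At its maximum the distance is at most half of itself.
  obtain ⟨x, hx, hmax⟩ := isCompact_Icc.exists_isMaxOn hne
    (f := fun t => |H t - K t|) (by have := hH.1; have := hK.1; fun_prop)
  have hmax' : ∀ t ∈ Set.Icc τ₀ s, |H t - K t| ≤ |H x - K x| := fun t ht => hmax ht
  have h1 := abs_integral_sub_le_of_isNear h01 hf hI hL0 hL hs hH hK (abs_nonneg _) hmax' hx
  have h2 : H x - K x = (∫ η in τ₀..x, f H η) - ∫ η in τ₀..x, f K η := by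
    rw [eH x hx, eK x hx, add_sub_add_left_eq_sub]
  rw [← h2] at h1
  have h3 : |H x - K x| ≤ 0 := by nlinarith [abs_nonneg (H x - K x)]
  exact fun t ht => sub_eq_zero.1 (abs_nonpos_iff.1 ((hmax' t ht).trans h3))

/-- Existence part of the continuation of a solution of a causal integral equation. -/
lemma exists_continuation (h01 : τ₀ ≤ τ₁) (h12 : τ₁ ≤ τ₂) (hr : 0 ≤ r) (hb : Continuous b)
    (hb1 : ∀ t, τ₁ ≤ t → b t = b τ₁)
    (eb : ∀ t ∈ Set.Icc τ₀ τ₁, b t = H₀ + ∫ η in τ₀..t, f b η)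
    (hf : ∀ H K t, τ₀ ≤ t → Set.EqOn H K (Set.Icc τ₀ t) → f H t = f K t)
    (hI : ∀ s ∈ Set.Icc τ₁ τ₂, ∀ K, IsNear b τ₀ τ₁ r s K → IntervalIntegrable (f K) volume τ₀ s)
    (hB0 : 0 ≤ B) (hB : ∀ s ∈ Set.Icc τ₁ τ₂, ∀ K, IsNear b τ₀ τ₁ r s K → |f K s| ≤ B)
    (hL0 : 0 ≤ L)
    (hL : ∀ s ∈ Set.Icc τ₁ τ₂, ∀ H K, IsNear b τ₀ τ₁ r s H → IsNear b τ₀ τ₁ r s K → ∀ δ, 0 ≤ δ →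
      (∀ t ∈ Set.Icc τ₀ s, |H t - K t| ≤ δ) → |f H s - f K s| ≤ L * δ)
    (hsmall : L * (τ₂ - τ₁) ≤ 1 / 2) (hsmall' : B * (τ₂ - τ₁) ≤ r / 2) :
    ∃ H, IsNear b τ₀ τ₁ (r / 2) τ₂ H ∧ ∀ t ∈ Set.Icc τ₀ τ₂, H t = H₀ + ∫ η in τ₀..t, f H η := by
  have h02 : τ₀ ≤ τ₂ := h01.trans h12
  have h2 : τ₂ ∈ Set.Icc τ₁ τ₂ := ⟨h12, le_rfl⟩
  -- Radius r/2, while the hypotheses hold up to r: the margin is used in the uniqueness proof.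
  let X : Set C(Set.Icc τ₀ τ₂, ℝ) :=
    {g | (∀ t : Set.Icc τ₀ τ₂, (t : ℝ) ≤ τ₁ → g t = b t) ∧
      ∀ t : Set.Icc τ₀ τ₂, |g t - b t| ≤ r / 2}
  have hXc : IsClosed X := by
    have e : X = (⋂ t : Set.Icc τ₀ τ₂, {g | (t : ℝ) ≤ τ₁ → g t = b t}) ∩
        ⋂ t : Set.Icc τ₀ τ₂, {g | |g t - b t| ≤ r / 2} := by
      ext g; simp [X]
    rw [e]
    refine (isClosed_iInter fun t => ?_).inter (isClosed_iInter fun t => ?_)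
    · by_cases ht : (t : ℝ) ≤ τ₁
      · simp only [ht, forall_const]
        exact isClosed_eq (ContinuousEvalConst.continuous_eval_const t) continuous_const
      · simp [ht]
    · exact isClosed_le ((ContinuousEvalConst.continuous_eval_const t).sub
        continuous_const).abs continuous_const
  let E : C(Set.Icc τ₀ τ₂, ℝ) → ℝ → ℝ := fun g t => g ⟨clamp τ₀ τ₂ t, clamp_mem h02 t⟩
  have hE : ∀ g (t : ℝ) (ht : t ∈ Set.Icc τ₀ τ₂), E g t = g ⟨t, ht⟩ := fun g t ht => by
    simp only [E, clamp_of_mem ht]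
  have hEc : ∀ g, Continuous (E g) := fun g =>
    g.continuous.comp ((continuous_clamp τ₀ τ₂).subtype_mk _)
  have hEn : ∀ g ∈ X, IsNear b τ₀ τ₁ (r / 2) τ₂ (E g) := fun g hg =>
    ⟨hEc g, fun t ht => by
      rw [hE g t ⟨ht.1, ht.2.trans h12⟩]; exact hg.1 ⟨t, ht.1, ht.2.trans h12⟩ ht.2,
      fun t ht => by rw [hE g t ht]; exact hg.2 ⟨t, ht⟩⟩
  have hEn' : ∀ g ∈ X, IsNear b τ₀ τ₁ r τ₂ (E g) := fun g hg =>
    ⟨hEc g, (hEn g hg).2, fun t ht => ((hEn g hg).3 t ht).trans (by linarith)⟩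
  have hcont : ∀ g ∈ X, ContinuousOn (fun t => H₀ + ∫ η in τ₀..t, f (E g) η)
      (Set.Icc τ₀ τ₂) := fun g hg => by
    have h := intervalIntegral.continuousOn_primitive_interval' (hI τ₂ h2 _ (hEn' g hg))
      Set.left_mem_uIcc
    rw [Set.uIcc_of_le h02] at h
    exact continuousOn_const.add h
  have hle : ∀ g ∈ X, ∀ t ∈ Set.Icc τ₀ τ₁, H₀ + ∫ η in τ₀..t, f (E g) η = b t := by
    intro g hg t ht
    rw [eb t ht, integral_congr_of_causal hf ht.1 fun x hx =>
      (hEn g hg).eqOn ⟨hx.1, hx.2.trans ht.2⟩]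
  have hge : ∀ g ∈ X, ∀ t ∈ Set.Icc τ₀ τ₂, |H₀ + (∫ η in τ₀..t, f (E g) η) - b t| ≤ r / 2 := by
    intro g hg t ht
    rcases le_total t τ₁ with htτ | htτ
    · rw [hle g hg t ⟨ht.1, htτ⟩, sub_self, abs_zero]; linarith
    · have hi := hI t ⟨htτ, ht.2⟩ _ ((hEn' g hg).mono ht.2)
      have hsub : Set.uIcc τ₀ τ₁ ⊆ Set.uIcc τ₀ t := by
        rw [Set.uIcc_of_le h01, Set.uIcc_of_le ht.1]
        exact Set.Icc_subset_Icc_right htτ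
      have hsub' : Set.uIcc τ₁ t ⊆ Set.uIcc τ₀ t := by
        rw [Set.uIcc_of_le htτ, Set.uIcc_of_le ht.1]
        exact Set.Icc_subset_Icc_left h01
      -- The part up to τ₁ reproduces b τ₁, which equals b t as b is constant from τ₁ on; only the
      -- integral over [τ₁, t] remains.
      rw [← intervalIntegral.integral_add_adjacent_intervals (hi.mono_set hsub)
        (hi.mono_set hsub'), ← add_assoc, hle g hg τ₁ ⟨h01, le_rfl⟩, hb1 t htτ,
        add_sub_cancel_left]
      exact (abs_intervalIntegral_le_mul htτ (by linarith [ht.2]) hB0 fun η hη =>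
        hB η ⟨hη.1, hη.2.trans ht.2⟩ _ ((hEn' g hg).mono (hη.2.trans ht.2))).trans hsmall'
  let Γ : X → X := fun g => ⟨⟨fun t => H₀ + ∫ η in τ₀..(t : ℝ), f (E g) η,
    continuousOn_iff_continuous_domRestrict.1 (hcont g g.2)⟩,
    fun t ht => hle g g.2 t ⟨t.2.1, ht⟩, fun t => hge g g.2 t t.2⟩
  have hΓ : ∀ g (t : Set.Icc τ₀ τ₂), (Γ g : C(Set.Icc τ₀ τ₂, ℝ)) t =
      H₀ + ∫ η in τ₀..(t : ℝ), f (E g) η := fun _ _ => rfl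
  have hcontr : ContractingWith (1 / 2) Γ := by
    refine ⟨by rw [← NNReal.coe_lt_coe]; norm_num, LipschitzWith.of_dist_le_mul fun g k => ?_⟩
    have hd : ∀ t ∈ Set.Icc τ₀ τ₂, |E g t - E k t| ≤ dist g k := fun t ht => by
      rw [hE _ t ht, hE _ t ht, ← Real.dist_eq]
      exact ContinuousMap.dist_apply_le_dist _
    rw [Subtype.dist_eq]
    refine (ContinuousMap.dist_le (by positivity)).2 fun t => ?_
    rw [hΓ, hΓ, Real.dist_eq, add_sub_add_left_eq_sub]
    refine (abs_integral_sub_le_of_isNear h01 hf hI hL0 hL h2 (hEn' g g.2) (hEn' k k.2)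
      dist_nonneg hd t.2).trans ?_
    have : (((1 / 2 : NNReal)) : ℝ) = 1 / 2 := by norm_num
    rw [this]
    nlinarith [dist_nonneg (x := g) (y := k)]
  have : CompleteSpace X := hXc.completeSpace_coe
  have : Nonempty X := ⟨⟨⟨fun t => b t, by fun_prop⟩, fun _ _ => rfl, fun t => by
    simpa using by linarith⟩⟩
  have hfix : Γ (hcontr.fixedPoint Γ) = hcontr.fixedPoint Γ := hcontr.fixedPoint_isFixedPt
  set g := hcontr.fixedPoint Γ with hg
  refine ⟨E g, hEn g g.2, fun t ht => ?_⟩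
  rw [← hΓ g ⟨t, ht⟩, hfix, hE _ t ht]

/-- Uniqueness of a continuation in the class of all continuous functions. -/
lemma eqOn_of_continuation (h01 : τ₀ ≤ τ₁) (hr : 0 < r) (hb : Continuous b)
    (hf : ∀ H K t, τ₀ ≤ t → Set.EqOn H K (Set.Icc τ₀ t) → f H t = f K t)
    (hI : ∀ s ∈ Set.Icc τ₁ τ₂, ∀ K, IsNear b τ₀ τ₁ r s K → IntervalIntegrable (f K) volume τ₀ s)
    (hL0 : 0 ≤ L)
    (hL : ∀ s ∈ Set.Icc τ₁ τ₂, ∀ H K, IsNear b τ₀ τ₁ r s H → IsNear b τ₀ τ₁ r s K → ∀ δ, 0 ≤ δ →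
      (∀ t ∈ Set.Icc τ₀ s, |H t - K t| ≤ δ) → |f H s - f K s| ≤ L * δ)
    (hsmall : L * (τ₂ - τ₁) ≤ 1 / 2) {H K : ℝ → ℝ} (hH : IsNear b τ₀ τ₁ (r / 2) τ₂ H)
    (eH : ∀ t ∈ Set.Icc τ₀ τ₂, H t = H₀ + ∫ η in τ₀..t, f H η)
    (hK : Continuous K) (hKb : Set.EqOn K b (Set.Icc τ₀ τ₁))
    (eK : ∀ t ∈ Set.Icc τ₀ τ₂, K t = H₀ + ∫ η in τ₀..t, f K η) :
    Set.EqOn K H (Set.Icc τ₀ τ₂) := by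
  have hHr : IsNear b τ₀ τ₁ r τ₂ H := ⟨hH.1, hH.2, fun t ht => (hH.3 t ht).trans (by linarith)⟩
  have hstart : Set.EqOn K H (Set.Icc τ₀ τ₁) := hKb.trans hH.eqOn.symm
  let S : Set ℝ := {t | Set.EqOn K H (Set.Icc τ₁ t)}
  -- The intersection below encodes agreement on [τ₁, t), a closed condition on t; continuity adds
  -- the endpoint, except for t = τ₁, where [τ₁, t) is empty and agreement up to τ₁ is used.
  have hScl : IsClosed (S ∩ Set.Icc τ₁ τ₂) := by
    have e : S ∩ Set.Icc τ₁ τ₂ =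
        (⋂ x : ℝ, {t | t ≤ x} ∪ {_t | x < τ₁ ∨ K x = H x}) ∩ Set.Icc τ₁ τ₂ := by
      ext t
      simp only [S, Set.mem_inter_iff, Set.mem_ofPred_eq, Set.mem_iInter, Set.mem_union]
      refine and_congr_left fun ht => ⟨fun h x => ?_, fun h => ?_⟩
      · by_contra! hx
        exact hx.2.2 (h ⟨hx.2.1, hx.1.le⟩)
      · have h1 : Set.EqOn K H (Set.Ico τ₁ t) := fun x hx => by
          rcases h x with h | h | h
          · exact absurd hx.2 (not_lt.2 h)
          · exact absurd hx.1 (not_le.2 h)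
          · exact h
        rcases ht.1.eq_or_lt with h2 | h2
        · intro x hx
          have : x = τ₁ := le_antisymm (hx.2.trans h2.ge) hx.1
          rw [this]
          exact hstart ⟨h01, le_rfl⟩
        · have := h1.closure hK hH.1
          rwa [closure_Ico h2.ne] at this
    rw [e]
    refine (isClosed_iInter fun x => (isClosed_le continuous_id continuous_const).union ?_).inter
      isClosed_Icc
    by_cases hx : x < τ₁ ∨ K x = H x <;> simp [hx]
  have hall : Set.Icc τ₁ τ₂ ⊆ S := by
    refine hScl.Icc_subset_of_forall_exists_gt ?_ ?_
    · intro x hx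
      have : x = τ₁ := le_antisymm hx.2 hx.1
      rw [this]
      exact hstart ⟨h01, le_rfl⟩
    · intro t ht y hy
      have htS : Set.EqOn K H (Set.Icc τ₁ t) := ht.1
      -- The strict inequality, from r/2 < r, persists shortly after t and brings K into the class
      -- of local uniqueness.
      have hKt : |K t - b t| < r := by
        rw [htS ⟨ht.2.1, le_rfl⟩]
        exact (hH.3 t ⟨h01.trans ht.2.1, ht.2.2.le⟩).trans_lt (by linarith)
      have hev : ∀ᶠ x in 𝓝 t, |K x - b x| < r :=
        ((hK.sub hb).abs.tendsto t).eventually (gt_mem_nhds hKt)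
      obtain ⟨δ, hδ, hball⟩ := Metric.eventually_nhds_iff.1 hev
      set s := min (t + δ / 2) (min y τ₂) with hs
      have hts : t < s := lt_min (by linarith) (lt_min hy ht.2.2)
      have hsy : s ≤ y := (min_le_right _ _).trans (min_le_left _ _)
      have hs2 : s ≤ τ₂ := (min_le_right _ _).trans (min_le_right _ _)
      have hsδ : s ≤ t + δ / 2 := min_le_left _ _
      have hsI : s ∈ Set.Icc τ₁ τ₂ := ⟨ht.2.1.trans hts.le, hs2⟩
      have hKn : IsNear b τ₀ τ₁ r s K := by
        refine ⟨hK, hKb, fun x hx => ?_⟩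
        rcases le_total x τ₁ with h1 | h1
        · rw [hKb ⟨hx.1, h1⟩, sub_self, abs_zero]; exact hr.le
        rcases le_total x t with h2 | h2
        · rw [htS ⟨h1, h2⟩]
          exact hHr.3 x ⟨hx.1, hx.2.trans hs2⟩
        · refine (hball ?_).le
          rw [Real.dist_eq, abs_of_nonneg (by linarith)]
          linarith [hx.2]
      have := eqOn_of_isNear h01 hf hI hL0 hL hsmall hsI hKn (hHr.mono hs2)
        (fun x hx => eK x ⟨hx.1, hx.2.trans hs2⟩) (fun x hx => eH x ⟨hx.1, hx.2.trans hs2⟩)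
      exact ⟨s, fun x hx => this ⟨h01.trans hx.1, hx.2⟩, hts, hsy⟩
  intro x hx
  rcases le_total x τ₁ with h1 | h1
  · exact hstart ⟨hx.1, h1⟩
  · exact hall ⟨h1, hx.2⟩ ⟨h1, le_rfl⟩

end Continuation

/-! ### Choice of the constants and conclusion -/

/-- Functions near a controlled one are controlled for a short time. -/
lemma IsNear.isControlled {a₀ τ₀ τ₁ s r h h₀ d σ : ℝ} {b K : ℝ → ℝ} (ha₀ : 0 < a₀)
    (h01 : τ₀ ≤ τ₁) (hσ : s - τ₁ ≤ σ) (hh : 0 ≤ h) (hr : h₀ + r ≤ h)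
    (hb : ∀ t, |b t| ≤ h₀) (hd : ∀ t ∈ Set.Icc τ₀ τ₁, 2 * d ≤ inverseScale a₀ τ₀ b t)
    (hd0 : 0 < d) (hsmall : a₀ * (h * σ) ≤ d) (hK : IsNear b τ₀ τ₁ r s K) :
    IsControlled a₀ τ₀ h d s K := by
  have hKh : ∀ t ∈ Set.Icc τ₀ s, |K t| ≤ h := fun t ht => by
    have h1 := hK.3 t ht
    have h2 := abs_sub_abs_le_abs_sub (K t) (b t)
    linarith [hb t]
  have hcongr : ∀ t ∈ Set.Icc τ₀ τ₁, inverseScale a₀ τ₀ K t = inverseScale a₀ τ₀ b t :=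
    fun t ht => by
      rw [inverseScale, inverseScale, intervalIntegral.integral_congr (g := b)]
      rw [Set.uIcc_of_le ht.1]
      exact fun x hx => hK.2 ⟨hx.1, hx.2.trans ht.2⟩
  refine ⟨hKh, fun t ht => ?_⟩
  rcases le_total t τ₁ with h1 | h1
  · rw [hcongr t ⟨ht.1, h1⟩]
    linarith [hd t ⟨ht.1, h1⟩]
  · have e : inverseScale a₀ τ₀ K t = inverseScale a₀ τ₀ K τ₁ - a₀ * ∫ η in τ₁..t, K η := by
      rw [inverseScale, inverseScale, ← intervalIntegral.integral_add_adjacent_intervals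
        (hK.1.intervalIntegrable τ₀ τ₁) (hK.1.intervalIntegrable τ₁ t)]
      ring
    have h2 : |∫ η in τ₁..t, K η| ≤ h * σ :=
      abs_intervalIntegral_le_mul h1 (by linarith [ht.2]) hh
        fun x hx => hKh x ⟨h01.trans hx.1, hx.2.trans ht.2⟩
    have h3 := mul_le_mul_of_nonneg_left ((le_abs_self _).trans h2) ha₀.le
    rw [e, hcongr τ₁ ⟨h01, le_rfl⟩]
    linarith [hd τ₁ ⟨h01, le_rfl⟩]

/-- The denominator A + 1 covers A = 0. -/
lemma exists_pos_mul_le {A c : ℝ} (hA : 0 ≤ A) (hc : 0 < c) :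
    ∃ σ > 0, ∀ σ', σ' ≤ σ → A * σ' ≤ c := by
  refine ⟨c / (A + 1), by positivity, fun σ' hσ' => ?_⟩
  calc A * σ' ≤ A * (c / (A + 1)) := by gcongr
    _ ≤ (A + 1) * (c / (A + 1)) := by gcongr; linarith
    _ = c := by field_simp

end SemiclassicalFriedmann

end

open SemiclassicalFriedmann in
theorem mainTheorem2
    (m lam G Lam a₀ H₀ τ₀ τ₁ : ℝ)
    (hm : 0 < m) (hlam : 0 < lam) (hG : 0 < G) (ha₀ : 0 < a₀) (hτ : τ₀ < τ₁)
    (Hs : ℝ → ℝ)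
    (hsol : SemiclassicalFriedmann.IsSolution m lam G Lam a₀ H₀ τ₀ τ₁ Hs)
    (hreg : SemiclassicalFriedmann.IsRegular G a₀ τ₀ τ₁ Hs) :
    ∃ τ₂ : ℝ, τ₁ < τ₂ ∧ ∃ H : ℝ → ℝ,
      Set.EqOn H Hs (Set.Icc τ₀ τ₁) ∧
      SemiclassicalFriedmann.IsSolution m lam G Lam a₀ H₀ τ₀ τ₂ H ∧
      SemiclassicalFriedmann.IsRegular G a₀ τ₀ τ₂ H ∧
      SemiclassicalFriedmann.Converges m lam G Lam a₀ τ₀ τ₂ H ∧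
      ∀ K : ℝ → ℝ,
        SemiclassicalFriedmann.IsSolution m lam G Lam a₀ H₀ τ₀ τ₂ K →
        Set.EqOn K Hs (Set.Icc τ₀ τ₁) →
        Set.EqOn K H (Set.Icc τ₀ τ₂) := by
  have h01 := hτ.le
  have hne : (Set.Icc τ₀ τ₁).Nonempty := ⟨τ₀, le_rfl, h01⟩
  set b : ℝ → ℝ := fun t => Hs (clamp τ₀ τ₁ t) with hbdef
  have hbc : Continuous b :=
    hsol.1.comp_continuous (continuous_clamp τ₀ τ₁) (clamp_mem h01)
  have hbH : Set.EqOn b Hs (Set.Icc τ₀ τ₁) := fun t ht => by simp only [hbdef, clamp_of_mem ht]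
  have hcausal : ∀ H K t, τ₀ ≤ t → Set.EqOn H K (Set.Icc τ₀ t) →
      friedmannIntegrand m lam G Lam a₀ τ₀ H t = friedmannIntegrand m lam G Lam a₀ τ₀ K t :=
    fun H K t ht h => friedmannIntegrand_congr m lam G Lam a₀ ht h
  have heb : ∀ t ∈ Set.Icc τ₀ τ₁, b t = H₀ + ∫ η in τ₀..t,
      friedmannIntegrand m lam G Lam a₀ τ₀ b η := fun t ht => by
    rw [integral_congr_of_causal hcausal ht.1 fun x hx => hbH ⟨hx.1, hx.2.trans ht.2⟩, hbH ht]
    exact hsol.2 t ht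
  obtain ⟨x, hx, hmax⟩ := isCompact_Icc.exists_isMaxOn hne hsol.1.abs
  set h₀ := |Hs x| with hh₀
  have hbh : ∀ t, |b t| ≤ h₀ := fun t => hmax (clamp_mem h01 t)
  have hh₀G : h₀ < criticalHubble G := hreg.1 x hx
  have hh₀0 : 0 ≤ h₀ := abs_nonneg _
  -- Midpoint between the maximum of |Hs| and the critical value, so that an r-neighbourhood stays
  -- below the latter.
  set h := (h₀ + criticalHubble G) / 2 with hh
  set r := h - h₀ with hr
  have hhG : h < criticalHubble G := by rw [hh]; linarith
  have hr0 : 0 < r := by rw [hr, hh]; linarith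
  have hh0 : 0 ≤ h := by linarith
  obtain ⟨y, hy, hmin⟩ := isCompact_Icc.exists_isMinOn hne
    (continuous_inverseScale a₀ τ₀ hbc).continuousOn
  -- Half of the minimum of a₀/a; the other half may be lost on [τ₁, τ₂].
  set d := inverseScale a₀ τ₀ b y / 2 with hd
  have hd0 : 0 < d := by
    have h1 := hreg.2 y hy
    have h2 : ∫ η in τ₀..y, b η = ∫ η in τ₀..y, Hs η := by
      refine intervalIntegral.integral_congr ?_
      rw [Set.uIcc_of_le hy.1]
      exact fun t ht => hbH ⟨ht.1, ht.2.trans hy.2⟩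
    rw [hd, inverseScale, h2]
    linarith
  have hbd : ∀ t ∈ Set.Icc τ₀ τ₁, 2 * d ≤ inverseScale a₀ τ₀ b t := fun t ht => by
    have := hmin ht
    simp only [Set.mem_ofPred_eq] at this
    rw [hd]; linarith
  -- The constants are fixed for lengths up to τ₁ - τ₀ + 1 before σ ≤ 1 is chosen, which avoids
  -- circularity.
  obtain ⟨L, B, hL0, hB0, hLB⟩ := exists_friedmannIntegrand_bounds (G := G) (ℓ := τ₁ - τ₀ + 1) lam
    Lam hm ha₀ hh0 hhG hd0 (by linarith)
  obtain ⟨σ₁, hσ₁, hs₁⟩ := exists_pos_mul_le (by positivity : 0 ≤ a₀ * h) hd0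
  obtain ⟨σ₂, hσ₂, hs₂⟩ := exists_pos_mul_le hB0 (half_pos hr0)
  obtain ⟨σ₃, hσ₃, hs₃⟩ := exists_pos_mul_le hL0 (by norm_num : (0 : ℝ) < 1 / 2)
  set σ := min 1 (min σ₁ (min σ₂ σ₃)) with hσ
  have hσ0 : 0 < σ := lt_min one_pos (lt_min hσ₁ (lt_min hσ₂ hσ₃))
  have hσ1 : σ ≤ 1 := min_le_left _ _
  have hσσ₁ : σ ≤ σ₁ := (min_le_right _ _).trans (min_le_left _ _)
  have hσσ₂ : σ ≤ σ₂ := (min_le_right _ _).trans ((min_le_right _ _).trans (min_le_left _ _))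
  have hσσ₃ : σ ≤ σ₃ := (min_le_right _ _).trans ((min_le_right _ _).trans (min_le_right _ _))
  set τ₂ := τ₁ + σ with hτ₂
  have h12 : τ₁ < τ₂ := by linarith
  have h02 : τ₀ ≤ τ₂ := by linarith
  have hdiff : τ₂ - τ₁ = σ := by rw [hτ₂]; ring
  have hctrl : ∀ s ∈ Set.Icc τ₁ τ₂, ∀ K, IsNear b τ₀ τ₁ r s K → IsControlled a₀ τ₀ h d s K :=
    fun s hs K hK => hK.isControlled ha₀ h01 (by linarith [hs.2] : s - τ₁ ≤ σ) hh0
      (by rw [hr]; linarith) hbh hbd hd0 (by rw [← mul_assoc]; exact hs₁ σ hσσ₁)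
  have hI : ∀ s ∈ Set.Icc τ₁ τ₂, ∀ K, IsNear b τ₀ τ₁ r s K →
      IntervalIntegrable (friedmannIntegrand m lam G Lam a₀ τ₀ K) volume τ₀ s := fun s hs K hK =>
    intervalIntegrable_friedmannIntegrand lam Lam hm ha₀ hh0 hhG hd0 (h01.trans hs.1) hK.1
      (hctrl s hs K hK)
  have hB : ∀ s ∈ Set.Icc τ₁ τ₂, ∀ K, IsNear b τ₀ τ₁ r s K →
      |friedmannIntegrand m lam G Lam a₀ τ₀ K s| ≤ B := fun s hs K hK =>
    (hLB τ₀ s (h01.trans hs.1) (by linarith [hs.2]) K hK.1 (hctrl s hs K hK)).1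
  have hL : ∀ s ∈ Set.Icc τ₁ τ₂, ∀ H K, IsNear b τ₀ τ₁ r s H → IsNear b τ₀ τ₁ r s K →
      ∀ δ, 0 ≤ δ → (∀ t ∈ Set.Icc τ₀ s, |H t - K t| ≤ δ) →
      |friedmannIntegrand m lam G Lam a₀ τ₀ H s -
        friedmannIntegrand m lam G Lam a₀ τ₀ K s| ≤ L * δ := fun s hs H K hH hK =>
    (hLB τ₀ s (h01.trans hs.1) (by linarith [hs.2]) H hH.1 (hctrl s hs H hH)).2 K hK.1
      (hctrl s hs K hK)
  have hsm : L * (τ₂ - τ₁) ≤ 1 / 2 := hs₃ _ (hdiff.trans_le hσσ₃)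
  have hsm' : B * (τ₂ - τ₁) ≤ r / 2 := hs₂ _ (hdiff.trans_le hσσ₂)
  have hb1 : ∀ t, τ₁ ≤ t → b t = b τ₁ := fun t ht => by
    simp only [hbdef, clamp, min_eq_right ht, min_self]
  obtain ⟨H, hH, eH⟩ := exists_continuation h01 h12.le hr0.le hbc hb1 heb hcausal hI hB0 hB hL0 hL
    hsm hsm'
  have hHr : IsNear b τ₀ τ₁ r τ₂ H := ⟨hH.1, hH.2, fun t ht => (hH.3 t ht).trans (by linarith)⟩
  have hHc := hctrl τ₂ ⟨h12.le, le_rfl⟩ H hHr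
  refine ⟨τ₂, h12, H, hH.eqOn.trans hbH, ⟨hH.1.continuousOn, eH⟩,
    ⟨fun t ht => (hHc.1 t ht).trans_lt hhG, fun t ht => ?_⟩,
    converges_of_isControlled lam Lam hm ha₀ hh0 hhG hd0 h02 hH.1 hHc, fun K hK hKs => ?_⟩
  · have := hd0.trans_le (hHc.2 t ht)
    rw [inverseScale] at this
    linarith
  -- K is continuous only on [τ₀, τ₂]; its constant extension solves the same equation by causality.
  · set K' : ℝ → ℝ := fun t => K (clamp τ₀ τ₂ t) with hK'
    have hKK : Set.EqOn K' K (Set.Icc τ₀ τ₂) := fun t ht => by simp only [hK', clamp_of_mem ht]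
    have hK'c : Continuous K' :=
      hK.1.comp_continuous (continuous_clamp τ₀ τ₂) (clamp_mem h02)
    have eK : ∀ t ∈ Set.Icc τ₀ τ₂, K' t = H₀ + ∫ η in τ₀..t,
        friedmannIntegrand m lam G Lam a₀ τ₀ K' η := fun t ht => by
      rw [integral_congr_of_causal hcausal ht.1 fun x hx => hKK ⟨hx.1, hx.2.trans ht.2⟩, hKK ht]
      exact hK.2 t ht
    have hK'b : Set.EqOn K' b (Set.Icc τ₀ τ₁) := fun t ht => by
      rw [hKK ⟨ht.1, ht.2.trans h12.le⟩, hKs ht, hbH ht]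
    exact hKK.symm.trans (eqOn_of_continuation h01 hr0 hbc hcausal hI hL0 hL hsm hH eH hK'c hK'b eK)
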